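/- Consider a network of $n$ queues with state $x\in\mathbb Z_{\ge 0}^n$. There are $m_u$ controlled routing events: event $k$ moves one unit from queue $s(k)$ to queue $d(k)\ne s(k)$, at rate $u_k x_{s(k)}$. There are $m_e$ exit events: event $j$ removes one unit from queue $e(j)$, at rate $\gamma_j x_{e(j)}$, $\gamma_j\ge 0$. Let $R_{\mathcal D}\in\mathbb Z^{n\times m_u}$ and $R_{\mathcal E}\in\mathbb Z^{n\times m_e}$ be the matrices whose columns are the changes of state caused by the routing and by the exit events, let $H\in\{0,1\}^{m_u\times n}$ and $E\in\{0,1\}^{m_e\times n}$ be given by $H_{ki}=1$ iff $i=s(k)$ and $E_{ji}=1$ iff $i=e(j)$, and let $\Gamma=\mathrm{diag}(\gamma_1,\dots,\gamma_{m_e})$. Let $T>0$, $u_{\max}\ge 0$, $q,c\in\mathbb R_{\ge 0}^n$, $v\in\mathbb R_{\ge 0}^{m_u}$. An admissible policy is $U(x,t)=\mathrm{diag}(u_1(x,t),\dots,u_{m_u}(x,t))$ with $u_k:\mathbb Z_{\ge 0}^n\times[0,T]\to[0,u_{\max}]$ measurable in $t$. Under the policy $U$ the state $X(t)$ is a measurable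 process whose probabilities $\mathbb P(x,t)=\Pr(X(t)=x)$ solve the master equation $$\frac{\partial \mathbb P(x,t)}{\partial t}=\sum_{i}\bigl[W_i(x-r_i,t)\,\mathbb P(x-r_i,t)-W_i(x,t)\,\mathbb P(x,t)\bigr]$$ in integrated form, the sum running over all routing and exit events, where $r_i$ is the change of state caused by event $i$ and $W_i(x,t)$ is its rate in state $x$ at time $t$ under $U$. The expected cost of $U$ from $x_0$ is $$\mathcal V_U(x_0,0)=\mathbb E\Bigl[c^TX(T)+\int_0^T\bigl(q^TX(t)+v^TU(X(t),t)HX(t)\bigr)\,dt\,\Bigm|\,X(0)=x_0\Bigr].$$ Let $y:[0,T]\to\mathbb R^n$ be a solution of $$\dot y^T(t)+q^T+y^T(t)R_{\mathcal E}\Gamma E+\frac{u_{\max}}2\Bigl(\bigl(y^T(t)R_{\mathcal D}+v^T\bigr)-\bigl|y^T(t)R_{\mathcal D}+v^T\bigr|\Bigr)H=0,\qquad y(T)=c,$$ with the absolute value taken entrywise. Then the policy $$U^*(x,t)=\mathrm{diag}\Bigl(\frac{u_{\max}}2\bigl(\mathbf 1-\mathrm{sgn}(y^T(t)R_{\mathcal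 D}+v^T)\bigr)\Bigr),$$ with $\mathrm{sgn}$ taken entrywise and $\mathrm{sgn}(0)$ given any fixed value in $[-1,1]$, is admissible and optimal: for every initial state $x_0\in\mathbb Z_{\ge 0}^n$ and every admissible policy $U$ the expected costs are well defined (a process exists, its cost is integrable, and the expectation is the same for all such processes) and $\mathcal V_{U^*}(x_0,0)\le\mathcal V_U(x_0,0)$. The policy $U^*$ does not depend on the state $x$, and the optimal value is $\min_U\mathcal V_U(x_0,0)=\mathcal V_{U^*}(x_0,0)=y^T(0)x_0$. -/

import Mathlib

open MeasureTheory Set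
open scoped Matrix

/-- A network of `n` infinite-server queues with `mu` controlled routing events and `me` exit
events. Routing event `k` moves one unit from queue `src k` to queue `dst k`; exit event `j`
removes one unit from queue `exitAt j`, each unit in that queue leaving at rate `γ j`. -/
structure QueueNetwork (n mu me : ℕ) where
  src : Fin mu → Fin n
  dst : Fin mu → Fin n
  src_ne_dst : ∀ k, src k ≠ dst k
  exitAt : Fin me → Fin n
  γ : Fin me → ℝ
  γ_nonneg : ∀ j, 0 ≤ γ j

/-- A time-varying state feedback: `u x t k` is the rate, per unit in the source queue, of routing
event `k` at time `t` in state `x`. The control matrix is `U(x,t) = Matrix.diagonal (u x t)`. -/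
abbrev Policy (n mu : ℕ) : Type := (Fin n → ℕ) → ℝ → Fin mu → ℝ

/-- The sign function, with the value `s₀` at `0`. -/
noncomputable def sgn (s₀ x : ℝ) : ℝ := if 0 < x then 1 else if x < 0 then -1 else s₀

namespace QueueNetwork

variable {n mu me : ℕ} (N : QueueNetwork n mu me)

/-- Change of state caused by a routing event. -/
def routeJump (k : Fin mu) (i : Fin n) : ℤ :=
  (if i = N.dst k then 1 else 0) - (if i = N.src k then 1 else 0)

/-- Change of state caused by an exit event. -/
def exitJump (j : Fin me) (i : Fin n) : ℤ := if i = N.exitAt j then -1 else 0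

/-- The state change matrix of the routing events; column `k` is `routeJump k`. -/
def RD : Matrix (Fin n) (Fin mu) ℝ := Matrix.of fun i k => (N.routeJump k i : ℝ)

/-- The state change matrix of the exit events; column `j` is `exitJump j`. -/
def RE : Matrix (Fin n) (Fin me) ℝ := Matrix.of fun i j => (N.exitJump j i : ℝ)

/-- The diagonal matrix of the service rates. -/
def Gam : Matrix (Fin me) (Fin me) ℝ := Matrix.diagonal N.γ

/-- `H k i = 1` if queue `i` is the source of routing event `k`, and `0` otherwise. -/
def H : Matrix (Fin mu) (Fin n) ℝ := Matrix.of fun k i => if i = N.src k then 1 else 0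

/-- `E j i = 1` if exit event `j` occurs at queue `i`, and `0` otherwise. -/
def E : Matrix (Fin me) (Fin n) ℝ := Matrix.of fun j i => if i = N.exitAt j then 1 else 0

/-- Rate of routing event `k` in state `z` at time `t`. (It is only ever multiplied by the
probability of the state `z`, which is `0` when `z` has a negative entry.) -/
def routeRate (u : Policy n mu) (k : Fin mu) (z : Fin n → ℤ) (t : ℝ) : ℝ :=
  u (fun i => (z i).toNat) t k * (z (N.src k) : ℝ)

/-- Rate of exit event `j` in state `z`. -/
def exitRate (j : Fin me) (z : Fin n → ℤ) : ℝ := N.γ j * (z (N.exitAt j) : ℝ)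

/-- Right-hand side of the Kolmogorov (master) equation at state `x` and time `t`, for the
probabilities `P` of the states at time `t` (with `P z = 0` if `z` has a negative entry). -/
def masterRHS (u : Policy n mu) (P : (Fin n → ℤ) → ℝ) (t : ℝ) (x : Fin n → ℤ) : ℝ :=
  (∑ j, (N.exitRate j (x - N.exitJump j) * P (x - N.exitJump j) - N.exitRate j x * P x)) +
  ∑ k, (N.routeRate u k (x - N.routeJump k) t * P (x - N.routeJump k)
    - N.routeRate u k x t * P x)

end QueueNetwork

/-- The probability that `X(t) = z`. -/
noncomputable def stateProb {n : ℕ} {Ω : Type*} [MeasurableSpace Ω] (ℙ : Measure Ω)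
    (X : ℝ → Ω → Fin n → ℕ) (t : ℝ) (z : Fin n → ℤ) : ℝ :=
  ℙ.real {ω | ∀ i, (X t ω i : ℤ) = z i}

/-- The admissible policies on the horizon `[0, T]`: feedbacks, measurable in time, all of whose
rates take values in `[0, umax]`. -/
def IsAdmissible {n mu : ℕ} (umax T : ℝ) (u : Policy n mu) : Prop :=
  ∀ x k, (∀ t ∈ Icc (0 : ℝ) T, u x t k ∈ Icc 0 umax) ∧
    Measurable fun t : Icc (0 : ℝ) T => u x t k

/-- `X` is a realisation on `[0, T]`, on the probability space `(Ω, ℙ)`, of the network under the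
policy `u` started in `x₀`: a measurable process whose state probabilities solve the master
equation. As the rates are only measurable in time, the equation is written in integrated form. -/
structure IsNetworkProcess {n mu me : ℕ} (N : QueueNetwork n mu me) (T : ℝ) (u : Policy n mu)
    (x₀ : Fin n → ℕ) {Ω : Type*} [MeasurableSpace Ω] (ℙ : Measure Ω)
    (X : ℝ → Ω → Fin n → ℕ) : Prop where
  measurable : Measurable fun p : Icc (0 : ℝ) T × Ω => X p.1 p.2
  initial : ∀ᵐ ω ∂ℙ, X 0 ω = x₀
  master : ∀ x : Fin n → ℕ, ∀ t ∈ Icc (0 : ℝ) T,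
    stateProb ℙ X t (fun i => (x i : ℤ)) = stateProb ℙ X 0 (fun i => (x i : ℤ)) +
      ∫ s in (0 : ℝ)..t, N.masterRHS u (stateProb ℙ X s) s (fun i => (x i : ℤ))

/-- The stage cost `qᵀ x + vᵀ U(x,t) H x`. -/
noncomputable def stageCost {n mu me : ℕ} (N : QueueNetwork n mu me) (q : Fin n → ℝ)
    (v : Fin mu → ℝ) (u : Policy n mu) (x : Fin n → ℕ) (t : ℝ) : ℝ :=
  q ⬝ᵥ (fun i => (x i : ℝ)) +
    v ⬝ᵥ ((Matrix.diagonal (u x t) * N.H) *ᵥ (fun i => (x i : ℝ)))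

/-- The cost of one trajectory: terminal cost plus the integral of the stage cost. -/
noncomputable def pathCost {n mu me : ℕ} (N : QueueNetwork n mu me) (q : Fin n → ℝ)
    (v : Fin mu → ℝ) (c : Fin n → ℝ) (T : ℝ) (u : Policy n mu) (ξ : ℝ → Fin n → ℕ) : ℝ :=
  c ⬝ᵥ (fun i => (ξ T i : ℝ)) + ∫ t in (0 : ℝ)..T, stageCost N q v u (ξ t) t

/-- The expected total cost of the policy `u` from the initial state `x₀` is well defined and
equal to `a`: the network under `u` can be realised, and in every realisation the cost of a
trajectory is (almost surely defined and) integrable, with expectation `a`. -/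
def HasCost.{w} {n mu me : ℕ} (N : QueueNetwork n mu me) (q : Fin n → ℝ)
    (v : Fin mu → ℝ) (c : Fin n → ℝ) (T : ℝ) (u : Policy n mu) (x₀ : Fin n → ℕ) (a : ℝ) : Prop :=
  (∃ (Ω : Type w) (_ : MeasurableSpace Ω) (ℙ : Measure Ω) (X : ℝ → Ω → Fin n → ℕ),
    IsProbabilityMeasure ℙ ∧ IsNetworkProcess N T u x₀ ℙ X) ∧
  ∀ (Ω : Type w) (_ : MeasurableSpace Ω) (ℙ : Measure Ω) (X : ℝ → Ω → Fin n → ℕ),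
    IsProbabilityMeasure ℙ → IsNetworkProcess N T u x₀ ℙ X →
      (∀ᵐ ω ∂ℙ, IntervalIntegrable (fun t => stageCost N q v u (X t ω) t) volume 0 T) ∧
      Integrable (fun ω => pathCost N q v c T u (fun t => X t ω)) ℙ ∧
      ∫ ω, pathCost N q v c T u (fun t => X t ω) ∂ℙ = a

/-- `u` is an optimal policy: it is admissible and, from every initial state, its expected cost is
at most that of every admissible policy (all these costs being well defined). -/
def IsOptimalPolicy.{w} {n mu me : ℕ} (N : QueueNetwork n mu me) (q : Fin n → ℝ)
    (v : Fin mu → ℝ) (c : Fin n → ℝ) (umax T : ℝ) (u : Policy n mu) : Prop :=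
  IsAdmissible umax T u ∧ ∀ u' : Policy n mu, IsAdmissible umax T u' → ∀ x₀ : Fin n → ℕ,
    ∃ a a' : ℝ, HasCost.{w} N q v c T u x₀ a ∧ HasCost.{w} N q v c T u' x₀ a' ∧ a ≤ a'

/-- `y` solves on `[0, T]` the backward equation
`ẏᵀ + qᵀ + yᵀ R_E Γ E + (umax / 2) ((yᵀ R_D + vᵀ) - |yᵀ R_D + vᵀ|) H = 0`, `y(T) = c`. -/
def SolvesBackward {n mu me : ℕ} (N : QueueNetwork n mu me) (q : Fin n → ℝ)
    (v : Fin mu → ℝ) (c : Fin n → ℝ) (umax T : ℝ) (y : ℝ → Fin n → ℝ) : Prop :=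
  y T = c ∧ ∃ y' : ℝ → Fin n → ℝ, ∀ t ∈ Icc (0 : ℝ) T,
    HasDerivWithinAt y (y' t) (Icc 0 T) t ∧
    y' t + q + y t ᵥ* (N.RE * N.Gam * N.E) +
      (umax / 2) • (((y t ᵥ* N.RD + v) - fun k => |(y t ᵥ* N.RD + v) k|) ᵥ* N.H) = 0

/-- The bang-bang policy `diag ((umax / 2) (1 - sgn (yᵀ(t) R_D + vᵀ)))`. -/
noncomputable def bangBang {n mu me : ℕ} (N : QueueNetwork n mu me) (v : Fin mu → ℝ)
    (umax s₀ : ℝ) (y : ℝ → Fin n → ℝ) : Policy n mu :=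
  fun _ t k => umax / 2 * (1 - sgn s₀ ((y t ᵥ* N.RD + v) k))

universe w

/-! The value function is linear, `V(x,t) = yᵀ(t) x`. Every rate is a per-unit rate times the
population of the source queue, so a policy enters the Bellman equation for a linear function only
through terms `u_k a_k x_{s(k)}`, with `a = yᵀ R_D + vᵀ`. As `x_{s(k)} ≥ 0`, the minimum over `u_k ∈
[0, umax]` is `(umax/2)(a_k - |a_k|) x_{s(k)}`, attained by a choice that depends only on the sign
of `a_k`. The backward equation is therefore the Bellman equation with the state factored out.
Dynkin's formula (`IsForwardSolution.dynkin`) and `hamiltonian_gap` write the cost of any policy as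
`yᵀ(0) x₀` plus the accumulated mean excess of the Hamiltonian over its minimum
(`SolvesBackward.meanCost_eq`). This excess is nonnegative for every policy and vanishes for the
bang-bang one.

The remaining work shows that costs are well defined. No event increases the total population, so
all mass stays in a finite box of states (`IsForwardSolution.eq_zero_of_notMem`), and the master
equation becomes a finite linear system with measurable coefficients. Uniformisation and a Picard
series give a nonnegative solution (`exists_isForwardSolution`), and Grönwall gives uniqueness
(`IsForwardSolution.unique`). The cost is additive in time, so its mean depends only on the one-time
marginals: any process with these marginals serves as a realisation, and Fubini
(`IsNetworkProcess.integral_pathCost`) yields the same mean for all of them. -/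

/-! ### Calculus: integration by parts and Grönwall -/

/-- Rates are only measurable in time, so state probabilities are merely absolutely continuous. The
product rule is applied to the primitives, which agree with `f` and `g` on `[a, b]`. -/
theorem mul_sub_mul_eq_integral_of_primitive {a b : ℝ} (hab : a ≤ b) {f g f' g' : ℝ → ℝ}
    (hf' : IntervalIntegrable f' volume a b) (hg' : IntervalIntegrable g' volume a b)
    (hf : ∀ t ∈ Icc a b, f t = f a + ∫ s in a..t, f' s)
    (hg : ∀ t ∈ Icc a b, g t = g a + ∫ s in a..t, g' s) :
    f b * g b - f a * g a = ∫ t in a..b, (f' t * g t + f t * g' t) := by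
  have key : ∀ {h h' : ℝ → ℝ}, IntervalIntegrable h' volume a b →
      AbsolutelyContinuousOnInterval (fun t => h a + ∫ s in a..t, h' s) a b := by
    intro h h' hh
    have h1 := hh.absolutelyContinuousOnInterval_intervalIntegral (c := a) (by simp)
    have h2 : AbsolutelyContinuousOnInterval (fun _ : ℝ => h a) a b :=
      (LipschitzOnWith.absolutelyContinuousOnInterval (K := 0)
        (LipschitzWith.const (h a)).lipschitzOnWith)
    exact h2.add h1
  have hder : ∀ {h h' : ℝ → ℝ}, IntervalIntegrable h' volume a b →
      ∀ᵐ t, t ∈ uIcc a b → deriv (fun t => h a + ∫ s in a..t, h' s) t = h' t := by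
    intro h h' hh
    filter_upwards [hh.ae_hasDerivAt_integral] with t ht hmem
    exact ((ht hmem a (by simp)).const_add (h a)).deriv
  have e := AbsolutelyContinuousOnInterval.integral_deriv_mul_eq_sub (key (h := f) hf')
    (key (h := g) hg')
  rw [← hf b ⟨hab, le_rfl⟩, ← hg b ⟨hab, le_rfl⟩] at e
  simp only [intervalIntegral.integral_same, add_zero] at e
  rw [← e]
  apply intervalIntegral.integral_congr_ae
  filter_upwards [hder (h := f) hf', hder (h := g) hg'] with t h1 h2 ht
  have ht' : t ∈ Icc a b := by
    rw [uIoc_of_le hab] at ht; exact ⟨ht.1.le, ht.2⟩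
  rw [h1 (by rwa [uIcc_of_le hab]), h2 (by rwa [uIcc_of_le hab]), ← hf t ht', ← hg t ht']

/-- Grönwall applied to the primitive of `D`, whose derivative is at most `K` times itself and which
starts at zero. -/
theorem eq_zero_of_le_mul_integral {T K : ℝ} {D : ℝ → ℝ} (hD : ContinuousOn D (Icc 0 T))
    (hD0 : ∀ t ∈ Icc 0 T, 0 ≤ D t) (hle : ∀ t ∈ Icc 0 T, D t ≤ K * ∫ s in 0..t, D s) :
    ∀ t ∈ Icc 0 T, D t = 0 := by
  intro t ht
  have hT : 0 ≤ T := ht.1.trans ht.2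
  have hint : IntervalIntegrable D volume 0 T := by
    apply ContinuousOn.intervalIntegrable; rwa [uIcc_of_le hT]
  have hnn : ∀ s ∈ Icc 0 T, 0 ≤ ∫ r in 0..s, D r := fun s hs =>
    intervalIntegral.integral_nonneg hs.1 fun r hr => hD0 r ⟨hr.1, hr.2.trans hs.2⟩
  have h := norm_le_gronwallBound_of_norm_deriv_right_le (f := fun t => ∫ s in 0..t, D s)
    (f' := D) (δ := 0) (K := K) (ε := 0) (a := 0) (b := T) ?_ ?_ ?_ ?_ t ht
  · have h0 : ∫ s in 0..t, D s = 0 := by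
      rw [sub_zero] at h
      simpa [gronwallBound_ε0_δ0] using h
    have := hle t ht
    rw [h0, mul_zero] at this
    exact le_antisymm this (hD0 t ht)
  · have := intervalIntegral.continuousOn_primitive_interval (μ := volume) (f := D) (a := 0) (b := T)
      (by rw [uIcc_of_le hT]; exact hD.integrableOn_Icc)
    rwa [uIcc_of_le hT] at this
  · intro x hx
    have hx' : x ∈ Icc 0 T := ⟨hx.1, hx.2.le⟩
    have hmono : IntervalIntegrable D volume 0 x :=
      hint.mono_set (by rw [uIcc_of_le hT, uIcc_of_le hx.1]; exact Icc_subset_Icc le_rfl hx.2.le)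
    have hmem : Icc x T ∈ nhdsWithin x (Ici x) := Icc_mem_nhdsGE hx.2
    have hmem' : Icc x T ∈ nhdsWithin x (Ioi x) := Icc_mem_nhdsGT hx.2
    have hsub : Icc x T ⊆ Icc 0 T := Icc_subset_Icc hx.1 le_rfl
    exact intervalIntegral.integral_hasDerivWithinAt_right (s := Ici x) (t := Ioi x) hmono
      ⟨Icc x T, hmem', (hD.mono hsub).aestronglyMeasurable measurableSet_Icc⟩
      ((((hD x hx').mono hsub).mono_of_mem_nhdsWithin hmem').mono le_rfl)
  · simp
  · intro x hx
    have hx' : x ∈ Icc 0 T := ⟨hx.1, hx.2.le⟩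
    rw [add_zero, Real.norm_of_nonneg (hD0 x hx'), Real.norm_of_nonneg (hnn x hx')]
    exact hle x hx'

/-! ### Linear systems with measurable coefficients: the Picard series -/

section Picard

variable {S : Type*} [Fintype S]

/-- The terms of the Picard (Dyson) series of the linear equation `g' = Q g`, `g 0 = p`. -/
noncomputable def picardTerm (Q : ℝ → S → S → ℝ) (p : S → ℝ) : ℕ → ℝ → S → ℝ
  | 0, _, x => p x
  | k + 1, t, x => ∫ s in (0 : ℝ)..t, ∑ y, Q s x y * picardTerm Q p k s y

variable {Q : ℝ → S → S → ℝ} {p : S → ℝ} {C : ℝ}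

theorem intervalIntegrable_of_measurable_of_bounded {f : ℝ → ℝ} (hf : Measurable f) {B : ℝ}
    (hB : ∀ t, |f t| ≤ B) (a b : ℝ) : IntervalIntegrable f volume a b := by
  rw [intervalIntegrable_iff]
  exact Measure.integrableOn_of_bounded (M := B) (by simp) hf.aestronglyMeasurable
    (by filter_upwards with t using hB t)

theorem intervalIntegrable_sum_mul (hQm : ∀ x y, Measurable fun t => Q t x y)
    (hQ : ∀ t x y, |Q t x y| ≤ C) {h : ℝ → S → ℝ} (x : S) {a b : ℝ}
    (hh : ∀ y, ContinuousOn (fun t => h t y) (uIcc a b)) :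
    IntervalIntegrable (fun s => ∑ y, Q s x y * h s y) volume a b := by
  have : (fun s => ∑ y, Q s x y * h s y) = ∑ y, fun s => Q s x y * h s y := by
    ext s; simp
  rw [this]
  exact IntervalIntegrable.sum _ fun y _ =>
    (intervalIntegrable_of_measurable_of_bounded (hQm x y) (fun t => hQ t x y) a b).mul_continuousOn
      (hh y)

theorem continuous_picardTerm (hQm : ∀ x y, Measurable fun t => Q t x y)
    (hQ : ∀ t x y, |Q t x y| ≤ C) (k : ℕ) : ∀ x, Continuous fun t => picardTerm Q p k t x := by
  induction k with
  | zero => intro x; simpa [picardTerm] using continuous_const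
  | succ k ih =>
    intro x
    simp only [picardTerm]
    exact intervalIntegral.continuous_primitive
      (fun a b => intervalIntegrable_sum_mul hQm hQ x fun y => (ih y).continuousOn) 0

theorem picardTerm_nonneg (hQ0 : ∀ t x y, 0 ≤ Q t x y) (hp : ∀ x, 0 ≤ p x) (k : ℕ) :
    ∀ t ≥ 0, ∀ x, 0 ≤ picardTerm Q p k t x := by
  induction k with
  | zero => intro t _ x; exact hp x
  | succ k ih =>
    intro t ht x
    exact intervalIntegral.integral_nonneg ht fun s hs =>
      Finset.sum_nonneg fun y _ => mul_nonneg (hQ0 s x y) (ih s hs.1 y)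

/-- Each iteration costs a factor `card S * C` from the sum, and the integration of `s ^ k` supplies
the new factor of the factorial. -/
theorem abs_picardTerm_le (hQ : ∀ t x y, |Q t x y| ≤ C) (k : ℕ) :
    ∀ t ≥ 0, ∀ x, |picardTerm Q p k t x| ≤
      (∑ y, |p y|) * ((Fintype.card S * C) * t) ^ k / k.factorial := by
  induction k with
  | zero =>
    intro t _ x
    simpa [picardTerm] using
      Finset.single_le_sum (f := fun y => |p y|) (fun y _ => abs_nonneg _) (Finset.mem_univ x)
  | succ k ih =>
    intro t ht x
    have hC : 0 ≤ C := (abs_nonneg _).trans (hQ 0 x x)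
    set B := ∑ y, |p y|
    set L := Fintype.card S * C
    calc |picardTerm Q p (k + 1) t x|
        ≤ ∫ s in 0..t, (B * L ^ (k + 1) / k.factorial) * s ^ k := by
          rw [← Real.norm_eq_abs]
          refine intervalIntegral.norm_integral_le_of_norm_le ht ?_
            (Continuous.intervalIntegrable (by fun_prop) _ _)
          filter_upwards with s hs
          calc ‖∑ y, Q s x y * picardTerm Q p k s y‖
              ≤ ∑ y, ‖Q s x y * picardTerm Q p k s y‖ := norm_sum_le _ _
            _ ≤ ∑ _y : S, C * (B * (L * s) ^ k / k.factorial) := by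
                refine Finset.sum_le_sum fun y _ => ?_
                rw [norm_mul]
                exact mul_le_mul (hQ s x y) (ih s hs.1.le y) (norm_nonneg _) hC
            _ = (B * L ^ (k + 1) / k.factorial) * s ^ k := by
                simp only [Finset.sum_const, Finset.card_univ, nsmul_eq_mul, L]
                ring
      _ = B * (L * t) ^ (k + 1) / (k + 1).factorial := by
          rw [intervalIntegral.integral_const_mul, integral_pow, Nat.factorial_succ]
          have : (k.factorial : ℝ) ≠ 0 := by positivity
          push_cast
          field_simp
          simp only [mul_pow]
          ring

/-- A linear system with bounded measurable nonnegative coefficients has a nonnegative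
continuous solution (in integrated form) for every nonnegative initial value. -/
theorem exists_nonneg_linear_solution (hQm : ∀ x y, Measurable fun t => Q t x y)
    (hQ : ∀ t x y, |Q t x y| ≤ C) (hQ0 : ∀ t x y, 0 ≤ Q t x y) (hp : ∀ x, 0 ≤ p x) :
    ∃ g : ℝ → S → ℝ, (∀ x, ContinuousOn (fun t => g t x) (Ici 0)) ∧ (∀ t ≥ 0, ∀ x, 0 ≤ g t x) ∧
      ∀ t ≥ 0, ∀ x, g t x = p x + ∫ s in (0 : ℝ)..t, ∑ y, Q s x y * g s y := by
  -- An element of `S` is needed to deduce `0 ≤ C` from the bound on the coefficients.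
  rcases isEmpty_or_nonempty S with hS | ⟨⟨x₁⟩⟩
  · exact ⟨fun _ _ => 0, fun x => hS.elim x, fun _ _ x => hS.elim x, fun _ _ x => hS.elim x⟩
  have hC : 0 ≤ C := (abs_nonneg _).trans (hQ 0 x₁ x₁)
  set B := ∑ y, |p y|
  have hB0 : 0 ≤ B := Finset.sum_nonneg fun _ _ => abs_nonneg _
  set L := Fintype.card S * C
  have hL0 : 0 ≤ L := by positivity
  let bd : ℝ → ℕ → ℝ := fun τ k => B * (L * τ) ^ k / k.factorial
  have hbd : ∀ τ, Summable (bd τ) := fun τ => by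
    simpa [bd, mul_div_assoc] using (Real.summable_pow_div_factorial (L * τ)).mul_left B
  have hle : ∀ τ, ∀ t ∈ Icc 0 τ, ∀ k x, |picardTerm Q p k t x| ≤ bd τ k := fun τ t ht k x => by
    refine (abs_picardTerm_le hQ k t ht.1 x).trans ?_
    have := ht.1
    have := ht.2
    simp only [bd]
    gcongr
  have hsum : ∀ t ≥ 0, ∀ x, Summable fun k => picardTerm Q p k t x := fun t ht x =>
    (hbd t).of_norm_bounded fun k => hle t t ⟨ht, le_rfl⟩ k x
  have hcts : ∀ x, ContinuousOn (fun t => ∑' k, picardTerm Q p k t x) (Ici 0) := fun x => by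
    intro t ht
    have : ContinuousOn (fun t => ∑' k, picardTerm Q p k t x) (Icc 0 (t + 1)) :=
      continuousOn_tsum (fun k => (continuous_picardTerm hQm hQ k x).continuousOn) (hbd (t + 1))
        fun k s hs => hle (t + 1) s hs k x
    refine (this t ⟨ht, by linarith⟩).mono_of_mem_nhdsWithin ?_
    exact Filter.mem_of_superset (inter_mem_nhdsWithin _ (Iio_mem_nhds (lt_add_one t)))
      fun s hs => ⟨hs.1, le_of_lt hs.2⟩
  refine ⟨fun t x => ∑' k, picardTerm Q p k t x, hcts,
    fun t ht x => tsum_nonneg fun k => picardTerm_nonneg hQ0 hp k t ht x, fun t ht x => ?_⟩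
  beta_reduce
  -- The zeroth term is the initial value; the shifted series is the integral of the series, by
  -- dominated convergence.
  rw [(hsum t ht x).tsum_eq_zero_add]
  congr 1
  simp only [picardTerm]
  refine HasSum.tsum_eq ?_
  refine intervalIntegral.hasSum_integral_of_dominated_convergence
    (bound := fun k _ => ∑ _y : S, C * bd t k) (fun k => ?_) (fun k => ?_) ?_ ?_ ?_
  · exact (intervalIntegrable_sum_mul hQm hQ x
      fun y => (continuous_picardTerm hQm hQ k y).continuousOn).def'.aestronglyMeasurable
  · filter_upwards with s hs
    rw [uIoc_of_le ht] at hs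
    refine (norm_sum_le _ _).trans (Finset.sum_le_sum fun y _ => ?_)
    rw [norm_mul]
    exact mul_le_mul (hQ s x y) (hle t s ⟨hs.1.le, hs.2⟩ k y) (norm_nonneg _) hC
  · filter_upwards with s hs
    exact summable_sum fun y _ => (hbd t).mul_left C
  · exact intervalIntegrable_const
  · filter_upwards with s hs
    rw [uIoc_of_le ht] at hs
    exact hasSum_sum fun y _ => ((hsum s hs.1.le y).hasSum).mul_left _

end Picard

/-! ### Shifted sums and the finite box of states -/

theorem sum_mul_comp_sub {A : Type*} [AddCommGroup A] {s : Finset A} {r : A} {G : A → ℝ}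
    (hG : ∀ w, G w ≠ 0 → w ∈ s ∧ w + r ∈ s) (f : A → ℝ) :
    ∑ z ∈ s, f z * G (z - r) = ∑ w ∈ s, f (w + r) * G w :=
  Finset.sum_bij_ne_zero (fun z _ _ => z - r)
    (fun _ _ h => (hG _ (right_ne_zero_of_mul h)).1) (fun _ _ _ _ _ _ h => sub_left_injective h)
    (fun w _ h => ⟨w + r, (hG w (right_ne_zero_of_mul h)).2, by simpa using h, by simp⟩)
    (fun z _ _ => by simp)

/-- Only mass inside `s` is assumed to stay in `s` under the shift. Mass entering from outside can
only enlarge the right-hand side. -/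
theorem sum_le_sum_comp_sub {A : Type*} [AddCommGroup A] {s : Finset A} {r : A}
    {G : A → ℝ} (hG0 : ∀ w, 0 ≤ G w) (hG : ∀ w ∈ s, G w ≠ 0 → w + r ∈ s) :
    ∑ z ∈ s, G z ≤ ∑ z ∈ s, G (z - r) := by
  classical
  calc ∑ z ∈ s, G z = ∑ z ∈ s with G z ≠ 0, G z := (Finset.sum_filter_ne_zero s).symm
    _ = ∑ z ∈ (s.filter fun z => G z ≠ 0).map (addRightEmbedding r), G (z - r) := by simp
    _ ≤ ∑ z ∈ s, G (z - r) := by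
      refine Finset.sum_le_sum_of_subset_of_nonneg (fun z hz => ?_) fun z _ _ => hG0 _
      obtain ⟨w, hw, rfl⟩ := Finset.mem_map.1 hz
      exact hG w (Finset.mem_filter.1 hw).1 (Finset.mem_filter.1 hw).2

/-- The states (as integer vectors) with nonnegative entries and total population at most `M`. -/
noncomputable def populationBox (n M : ℕ) : Finset (Fin n → ℤ) :=
  (Finset.Icc 0 fun _ => (M : ℤ)).filter fun z => ∑ i, z i ≤ M

theorem mem_populationBox {n M : ℕ} {z : Fin n → ℤ} :
    z ∈ populationBox n M ↔ 0 ≤ z ∧ ∑ i, z i ≤ M := by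
  simp only [populationBox, Finset.mem_filter, Finset.mem_Icc]
  refine ⟨fun h => ⟨h.1.1, h.2⟩, fun h => ⟨⟨h.1, fun i => ?_⟩, h.2⟩⟩
  exact (Finset.single_le_sum (fun j _ => h.1 j) (Finset.mem_univ i)).trans h.2

/-- The feedback `u` is measurable in time with values in `[0, umax]`, at all times. -/
def IsRegularPolicy {n mu : ℕ} (umax : ℝ) (u : Policy n mu) : Prop :=
  ∀ x k, (Measurable fun t => u x t k) ∧ ∀ t, u x t k ∈ Icc 0 umax

/-! ### Events and the generator -/

namespace QueueNetwork

variable {n mu me : ℕ} (N : QueueNetwork n mu me) {umax : ℝ} {u : Policy n mu}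

/-- The queue left by the moving unit in an event (an exit or a routing event). -/
def eventSrc : Fin me ⊕ Fin mu → Fin n := Sum.elim N.exitAt N.src

/-- The change of state in an event. -/
def eventJump : Fin me ⊕ Fin mu → Fin n → ℤ := Sum.elim N.exitJump N.routeJump

/-- The rate of an event per unit in its source queue. -/
def unitRate (u : Policy n mu) (e : Fin me ⊕ Fin mu) (x : Fin n → ℕ) (t : ℝ) : ℝ :=
  Sum.elim N.γ (u x t) e

/-- The rate of an event. -/
def eventRate (u : Policy n mu) (e : Fin me ⊕ Fin mu) (z : Fin n → ℤ) (t : ℝ) : ℝ :=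
  N.unitRate u e (fun i => (z i).toNat) t * (z (N.eventSrc e) : ℝ)

/-- Exit and routing events are merged into one family, so that each later argument is made once. -/
theorem masterRHS_eq_sum_event (P : (Fin n → ℤ) → ℝ) (t : ℝ) (z : Fin n → ℤ) :
    N.masterRHS u P t z = ∑ e, (N.eventRate u e (z - N.eventJump e) t * P (z - N.eventJump e)
      - N.eventRate u e z t * P z) := by
  rw [Fintype.sum_sum_type]
  rfl

theorem eventJump_src (e : Fin me ⊕ Fin mu) : N.eventJump e (N.eventSrc e) = -1 := by
  rcases e with j | k
  · simp [eventJump, eventSrc, exitJump]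
  · simp [eventJump, eventSrc, routeJump, N.src_ne_dst k]

theorem eventJump_nonneg {e : Fin me ⊕ Fin mu} {i : Fin n} (h : i ≠ N.eventSrc e) :
    0 ≤ N.eventJump e i := by
  rcases e with j | k
  · simp only [eventSrc, Sum.elim_inl] at h
    simp [eventJump, exitJump, h]
  · simp only [eventSrc, Sum.elim_inr] at h
    simp only [eventJump, routeJump, Sum.elim_inr, h, if_false]
    split_ifs <;> simp

theorem sum_eventJump_nonpos (e : Fin me ⊕ Fin mu) : ∑ i, N.eventJump e i ≤ 0 := by
  rcases e with j | k
  · simp [eventJump, exitJump]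
  · simp [eventJump, routeJump]

/-- Only the source queue loses anything, and it loses exactly one unit. -/
theorem add_eventJump_nonneg {e : Fin me ⊕ Fin mu} {z : Fin n → ℤ} (hz : 0 ≤ z)
    (h : z (N.eventSrc e) ≠ 0) : 0 ≤ z + N.eventJump e := by
  intro i
  have hi : 0 ≤ z i := hz i
  change (0 : ℤ) ≤ z i + N.eventJump e i
  by_cases hie : i = N.eventSrc e
  · subst hie
    rw [eventJump_src]
    omega
  · exact add_nonneg hi (N.eventJump_nonneg hie)

theorem add_eventJump_mem_populationBox {e : Fin me ⊕ Fin mu} {M : ℕ} {z : Fin n → ℤ}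
    (hz : z ∈ populationBox n M) (h : z (N.eventSrc e) ≠ 0) :
    z + N.eventJump e ∈ populationBox n M := by
  rw [mem_populationBox] at hz ⊢
  refine ⟨N.add_eventJump_nonneg hz.1 h, ?_⟩
  simp only [Pi.add_apply, Finset.sum_add_distrib]
  linarith [hz.2, N.sum_eventJump_nonpos e]

theorem src_ne_zero_of_eventRate_ne_zero {e : Fin me ⊕ Fin mu} {z : Fin n → ℤ} {t : ℝ}
    (h : N.eventRate u e z t ≠ 0) : z (N.eventSrc e) ≠ 0 := by
  rintro h0
  exact h (by simp [eventRate, h0])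

/-- Summation by parts: the master equation is the adjoint of the generator. There are no boundary
terms, because events of nonzero rate do not leave the box. -/
theorem sum_mul_masterRHS {M : ℕ} {P : (Fin n → ℤ) → ℝ}
    (hP : ∀ z, z ∉ populationBox n M → P z = 0) (t : ℝ) (f : (Fin n → ℤ) → ℝ) :
    ∑ z ∈ populationBox n M, f z * N.masterRHS u P t z =
      ∑ z ∈ populationBox n M,
        P z * ∑ e, N.eventRate u e z t * (f (z + N.eventJump e) - f z) := by
  have key : ∀ e, ∑ z ∈ populationBox n M,
      f z * (N.eventRate u e (z - N.eventJump e) t * P (z - N.eventJump e)) =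
      ∑ z ∈ populationBox n M, f (z + N.eventJump e) * (N.eventRate u e z t * P z) := fun e =>
    sum_mul_comp_sub (G := fun z => N.eventRate u e z t * P z) (fun w hw => by
      have hmem : w ∈ populationBox n M := by
        by_contra hn
        exact hw (by simp [hP w hn])
      exact ⟨hmem, N.add_eventJump_mem_populationBox hmem
        (N.src_ne_zero_of_eventRate_ne_zero (left_ne_zero_of_mul hw))⟩) f
  simp only [masterRHS_eq_sum_event, Finset.mul_sum]
  rw [Finset.sum_comm]
  conv_rhs => rw [Finset.sum_comm]
  refine Finset.sum_congr rfl fun e _ => ?_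
  simp only [mul_sub, Finset.sum_sub_distrib]
  rw [key]
  congr 1 <;> exact Finset.sum_congr rfl fun z _ => by ring

theorem unitRate_nonneg (hu : IsRegularPolicy umax u) (e : Fin me ⊕ Fin mu) (x : Fin n → ℕ)
    (t : ℝ) : 0 ≤ N.unitRate u e x t := by
  rcases e with j | k
  · exact N.γ_nonneg j
  · exact ((hu x k).2 t).1

theorem unitRate_le (humax : 0 ≤ umax) (hu : IsRegularPolicy umax u) (e : Fin me ⊕ Fin mu)
    (x : Fin n → ℕ) (t : ℝ) : N.unitRate u e x t ≤ (∑ j, N.γ j) + umax := by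
  rcases e with j | k
  · have := Finset.single_le_sum (fun j _ => N.γ_nonneg j) (Finset.mem_univ j)
    simp only [unitRate, Sum.elim_inl]
    linarith
  · have := Finset.sum_nonneg fun j (_ : j ∈ Finset.univ) => N.γ_nonneg j
    have := ((hu x k).2 t).2
    simp only [unitRate, Sum.elim_inr]
    linarith

theorem measurable_eventRate (hu : IsRegularPolicy umax u) (e : Fin me ⊕ Fin mu)
    (z : Fin n → ℤ) : Measurable (N.eventRate u e z) := by
  refine Measurable.mul_const ?_ _
  rcases e with j | k
  · exact measurable_const
  · exact (hu _ k).1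

theorem eventRate_nonneg (hu : IsRegularPolicy umax u) (e : Fin me ⊕ Fin mu)
    {z : Fin n → ℤ} (hz : 0 ≤ z) (t : ℝ) : 0 ≤ N.eventRate u e z t :=
  mul_nonneg (N.unitRate_nonneg hu e _ t) (by exact_mod_cast hz _)

theorem abs_eventRate_le (humax : 0 ≤ umax) (hu : IsRegularPolicy umax u) (e : Fin me ⊕ Fin mu)
    (z : Fin n → ℤ) (t : ℝ) :
    |N.eventRate u e z t| ≤ ((∑ j, N.γ j) + umax) * |(z (N.eventSrc e) : ℝ)| := by
  rw [eventRate, abs_mul, abs_of_nonneg (N.unitRate_nonneg hu e _ t)]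
  exact mul_le_mul_of_nonneg_right (N.unitRate_le humax hu e _ t) (abs_nonneg _)

/-- The net flow into the box is inward, since no event leads out of it. `P` is not assumed to
vanish outside, so this can be used to prove that it does. -/
theorem sum_masterRHS_nonneg (hu : IsRegularPolicy umax u) {P : (Fin n → ℤ) → ℝ}
    (hP0 : ∀ z, 0 ≤ P z) (hP : ∀ z, ¬ 0 ≤ z → P z = 0) (M : ℕ) (t : ℝ) :
    0 ≤ ∑ z ∈ populationBox n M, N.masterRHS u P t z := by
  simp only [masterRHS_eq_sum_event]
  rw [Finset.sum_comm]
  refine Finset.sum_nonneg fun e _ => ?_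
  rw [Finset.sum_sub_distrib, sub_nonneg]
  refine sum_le_sum_comp_sub (G := fun z => N.eventRate u e z t * P z) (fun w => ?_)
    fun w hw h => N.add_eventJump_mem_populationBox hw
      (N.src_ne_zero_of_eventRate_ne_zero (left_ne_zero_of_mul h))
  by_cases hw : 0 ≤ w
  · exact mul_nonneg (N.eventRate_nonneg hu e hw t) (hP0 w)
  · simp [hP w hw]

/-- An empty queue is left at rate zero, so negative states are never entered. This extends the
master equation from `ℕⁿ` to all of `ℤⁿ`. -/
theorem masterRHS_eq_zero_of_not_nonneg {P : (Fin n → ℤ) → ℝ} (hP : ∀ z, ¬ 0 ≤ z → P z = 0)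
    (t : ℝ) {z : Fin n → ℤ} (hz : ¬ 0 ≤ z) : N.masterRHS u P t z = 0 := by
  rw [masterRHS_eq_sum_event]
  refine Finset.sum_eq_zero fun e _ => ?_
  rw [hP z hz, mul_zero, sub_zero]
  by_cases hw : 0 ≤ z - N.eventJump e
  · by_contra h
    have := N.add_eventJump_nonneg hw
      (N.src_ne_zero_of_eventRate_ne_zero (left_ne_zero_of_mul h))
    rw [sub_add_cancel] at this
    exact hz this
  · rw [hP _ hw, mul_zero]

end QueueNetwork

namespace QueueNetwork

variable {n mu me : ℕ} (N : QueueNetwork n mu me) {umax : ℝ} {u : Policy n mu}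

/-- A constant bounding the master equation's right-hand side at the state `z`. -/
noncomputable def masterBound (umax : ℝ) (z : Fin n → ℤ) : ℝ :=
  ∑ e, (((∑ j, N.γ j) + umax) * |((z - N.eventJump e) (N.eventSrc e) : ℝ)| +
    ((∑ j, N.γ j) + umax) * |(z (N.eventSrc e) : ℝ)|)

theorem abs_masterRHS_le (humax : 0 ≤ umax) (hu : IsRegularPolicy umax u)
    {P : (Fin n → ℤ) → ℝ} {b : ℝ} (hP : ∀ z, |P z| ≤ b) (t : ℝ) (z : Fin n → ℤ) :
    |N.masterRHS u P t z| ≤ N.masterBound umax z * b := by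
  have h : ∀ e w, |N.eventRate u e w t * P w| ≤
      ((∑ j, N.γ j) + umax) * |(w (N.eventSrc e) : ℝ)| * b := fun e w => by
    rw [abs_mul]
    exact mul_le_mul (N.abs_eventRate_le humax hu e w t) (hP w) (abs_nonneg _)
      ((abs_nonneg _).trans (N.abs_eventRate_le humax hu e w t))
  rw [masterRHS_eq_sum_event, masterBound, Finset.sum_mul]
  refine (Finset.abs_sum_le_sum_abs _ _).trans (Finset.sum_le_sum fun e _ => ?_)
  rw [add_mul]
  exact (abs_sub _ _).trans (add_le_add (h e _) (h e z))

theorem masterRHS_sub (P P' : (Fin n → ℤ) → ℝ) (t : ℝ) (z : Fin n → ℤ) :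
    N.masterRHS u (P - P') t z = N.masterRHS u P t z - N.masterRHS u P' t z := by
  simp only [masterRHS_eq_sum_event, ← Finset.sum_sub_distrib, Pi.sub_apply]
  exact Finset.sum_congr rfl fun e _ => by ring

theorem measurable_masterRHS (hu : IsRegularPolicy umax u) {P : ℝ → (Fin n → ℤ) → ℝ}
    (hP : ∀ z, Measurable fun t => P t z) (z : Fin n → ℤ) :
    Measurable fun t => N.masterRHS u (P t) t z := by
  simp only [masterRHS_eq_sum_event]
  exact Finset.measurable_sum _ fun e _ =>
    ((N.measurable_eventRate hu e _).mul (hP _)).sub ((N.measurable_eventRate hu e _).mul (hP z))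

end QueueNetwork

/-! ### Solutions of the master equation: confinement, uniqueness, Dynkin's formula -/

/-- `P t` is a (sub)probability on `ℤⁿ`, carried by the states with nonnegative entries, that
starts as the point mass at `x₀` and solves the master equation on `[0, T]`. -/
structure IsForwardSolution {n mu me : ℕ} (N : QueueNetwork n mu me) (T : ℝ) (u : Policy n mu)
    (x₀ : Fin n → ℕ) (P : ℝ → (Fin n → ℤ) → ℝ) : Prop where
  measurable : ∀ z, Measurable fun t => P t z
  nonneg : ∀ t z, 0 ≤ P t z
  sum_le_one : ∀ t (s : Finset (Fin n → ℤ)), ∑ z ∈ s, P t z ≤ 1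
  eq_zero_of_not_nonneg : ∀ t z, ¬ 0 ≤ z → P t z = 0
  initial : ∀ z, P 0 z = if z = fun i => (x₀ i : ℤ) then 1 else 0
  master_of_nonneg : ∀ z, 0 ≤ z → ∀ t ∈ Icc 0 T,
    P t z = P 0 z + ∫ s in (0 : ℝ)..t, N.masterRHS u (P s) s z

namespace IsForwardSolution

variable {n mu me : ℕ} {N : QueueNetwork n mu me} {T umax : ℝ} {u : Policy n mu}
  {x₀ : Fin n → ℕ} {P P' : ℝ → (Fin n → ℤ) → ℝ}

theorem le_one (h : IsForwardSolution N T u x₀ P) (t : ℝ) (z : Fin n → ℤ) : P t z ≤ 1 := by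
  simpa using h.sum_le_one t {z}

theorem master (h : IsForwardSolution N T u x₀ P) (z : Fin n → ℤ) {t : ℝ} (ht : t ∈ Icc 0 T) :
    P t z = P 0 z + ∫ s in (0 : ℝ)..t, N.masterRHS u (P s) s z := by
  by_cases hz : 0 ≤ z
  · exact h.master_of_nonneg z hz t ht
  · have : ∀ s, N.masterRHS u (P s) s z = 0 := fun s =>
      N.masterRHS_eq_zero_of_not_nonneg (h.eq_zero_of_not_nonneg s) s hz
    simp [this, h.eq_zero_of_not_nonneg _ z hz]

theorem intervalIntegrable_masterRHS (humax : 0 ≤ umax) (hu : IsRegularPolicy umax u)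
    (h : IsForwardSolution N T u x₀ P) (z : Fin n → ℤ) (a b : ℝ) :
    IntervalIntegrable (fun s => N.masterRHS u (P s) s z) volume a b :=
  intervalIntegrable_of_measurable_of_bounded (N.measurable_masterRHS hu h.measurable z)
    (fun t => N.abs_masterRHS_le humax hu (b := 1)
      (fun w => by rw [abs_of_nonneg (h.nonneg t w)]; exact h.le_one t w) t z) a b

theorem continuousOn (humax : 0 ≤ umax) (hu : IsRegularPolicy umax u)
    (h : IsForwardSolution N T u x₀ P) (z : Fin n → ℤ) :
    ContinuousOn (fun t => P t z) (Icc 0 T) :=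
  ((continuous_const.add (intervalIntegral.continuous_primitive
    (fun a b => h.intervalIntegrable_masterRHS humax hu z a b) 0)).continuousOn).congr
    fun _ ht => h.master z ht

theorem cast_mem_populationBox (x₀ : Fin n → ℕ) :
    (fun i => (x₀ i : ℤ)) ∈ populationBox n (∑ i, x₀ i) := by
  rw [mem_populationBox]
  exact ⟨fun i => by simp, by simp⟩

/-- The box holds all the initial mass and its mass cannot decrease, while the total mass is at most
one. -/
theorem sum_eq_one (humax : 0 ≤ umax) (hu : IsRegularPolicy umax u)
    (h : IsForwardSolution N T u x₀ P) {t : ℝ} (ht : t ∈ Icc 0 T) :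
    ∑ z ∈ populationBox n (∑ i, x₀ i), P t z = 1 := by
  refine le_antisymm (h.sum_le_one t _) ?_
  rw [Finset.sum_congr rfl fun z _ => h.master z ht, Finset.sum_add_distrib,
    ← intervalIntegral.integral_finsetSum
      fun z _ => h.intervalIntegrable_masterRHS humax hu z 0 t]
  have h0 : ∑ z ∈ populationBox n (∑ i, x₀ i), P 0 z = 1 := by
    simp [h.initial, cast_mem_populationBox]
  have := intervalIntegral.integral_nonneg (μ := volume) ht.1 fun s _ =>
    N.sum_masterRHS_nonneg hu (h.nonneg s) (h.eq_zero_of_not_nonneg s) (∑ i, x₀ i) s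
  linarith

theorem eq_zero_of_notMem (humax : 0 ≤ umax) (hu : IsRegularPolicy umax u)
    (h : IsForwardSolution N T u x₀ P) {t : ℝ} (ht : t ∈ Icc 0 T) {z : Fin n → ℤ}
    (hz : z ∉ populationBox n (∑ i, x₀ i)) : P t z = 0 := by
  have h1 := h.sum_le_one t (insert z (populationBox n (∑ i, x₀ i)))
  rw [Finset.sum_insert hz, h.sum_eq_one humax hu ht] at h1
  exact le_antisymm (by linarith) (h.nonneg t z)

/-- Both solutions live in the same box, so their `ℓ¹` distance `D` there bounds every pointwise
difference. Linearity of the master equation then bounds `D` by a multiple of its own integral. -/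
theorem unique (humax : 0 ≤ umax) (hu : IsRegularPolicy umax u)
    (h : IsForwardSolution N T u x₀ P) (h' : IsForwardSolution N T u x₀ P')
    {t : ℝ} (ht : t ∈ Icc 0 T) (z : Fin n → ℤ) : P t z = P' t z := by
  set F := populationBox n (∑ i, x₀ i)
  let D : ℝ → ℝ := fun t => ∑ z ∈ F, |P t z - P' t z|
  have hDc : ContinuousOn D (Icc 0 T) := continuousOn_finsetSum _ fun z _ =>
    ((h.continuousOn humax hu z).sub (h'.continuousOn humax hu z)).abs
  have hD0 : ∀ t, 0 ≤ D t := fun t => Finset.sum_nonneg fun _ _ => abs_nonneg _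
  have hle : ∀ t ∈ Icc 0 T, ∀ z, |P t z - P' t z| ≤ D t := fun t ht z => by
    by_cases hz : z ∈ F
    · exact Finset.single_le_sum (f := fun z => |P t z - P' t z|) (fun _ _ => abs_nonneg _) hz
    · rw [h.eq_zero_of_notMem humax hu ht hz, h'.eq_zero_of_notMem humax hu ht hz]
      simpa using hD0 t
  have hzero := eq_zero_of_le_mul_integral (K := ∑ z ∈ F, N.masterBound umax z) hDc
    (fun t _ => hD0 t) (fun t ht => ?_) t ht
  · have := hle t ht z
    rw [hzero] at this
    exact sub_eq_zero.1 (abs_nonpos_iff.1 this)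
  · have hDi : IntervalIntegrable D volume 0 t :=
      (hDc.mono (Icc_subset_Icc le_rfl ht.2)).intervalIntegrable_of_Icc ht.1
    rw [Finset.sum_mul]
    refine Finset.sum_le_sum fun z _ => ?_
    rw [h.master z ht, h'.master z ht, h.initial, h'.initial, add_sub_add_left_eq_sub,
      ← intervalIntegral.integral_sub (h.intervalIntegrable_masterRHS humax hu z 0 t)
        (h'.intervalIntegrable_masterRHS humax hu z 0 t), ← Real.norm_eq_abs,
      ← intervalIntegral.integral_const_mul]
    refine intervalIntegral.norm_integral_le_of_norm_le ht.1 ?_ (hDi.const_mul _)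
    filter_upwards with s hs
    rw [← N.masterRHS_sub]
    exact N.abs_masterRHS_le humax hu (hle s ⟨hs.1.le, hs.2.trans ht.2⟩) s z

/-- Dynkin's formula for a function that is linear in the state. -/
theorem dynkin (hT : 0 ≤ T) (humax : 0 ≤ umax) (hu : IsRegularPolicy umax u)
    (h : IsForwardSolution N T u x₀ P) {y y' : ℝ → Fin n → ℝ}
    (hy : ∀ t ∈ Icc 0 T, HasDerivWithinAt y (y' t) (Icc 0 T) t)
    (hy' : ContinuousOn y' (Icc 0 T)) :
    ∑ z ∈ populationBox n (∑ i, x₀ i), P T z * (y T ⬝ᵥ fun i => (z i : ℝ)) =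
      (y 0 ⬝ᵥ fun i => (x₀ i : ℝ)) + ∫ t in 0..T, ∑ z ∈ populationBox n (∑ i, x₀ i),
        P t z * ((y' t ⬝ᵥ fun i => (z i : ℝ)) +
          ∑ e, N.eventRate u e z t * (y t ⬝ᵥ fun i => (N.eventJump e i : ℝ))) := by
  set F := populationBox n (∑ i, x₀ i)
  have hder : ∀ (z : Fin n → ℤ), ∀ t ∈ Icc 0 T,
      HasDerivWithinAt (fun t => y t ⬝ᵥ fun i => (z i : ℝ)) (y' t ⬝ᵥ fun i => (z i : ℝ))
        (Icc 0 T) t := fun z t ht => by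
    simp only [dotProduct]
    exact HasDerivWithinAt.fun_sum fun i _ => (hasDerivWithinAt_pi.1 (hy t ht) i).mul_const _
  have hcont' : ∀ z : Fin n → ℤ, ContinuousOn (fun t => y' t ⬝ᵥ fun i => (z i : ℝ)) (Icc 0 T) :=
    fun z => by
      simp only [dotProduct]
      exact continuousOn_finsetSum _ fun i _ => (continuousOn_pi.1 hy' i).mul continuousOn_const
  have hcont : ∀ z : Fin n → ℤ, ContinuousOn (fun t => y t ⬝ᵥ fun i => (z i : ℝ)) (Icc 0 T) :=
    fun z t ht => (hder z t ht).continuousWithinAt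
  have hftc : ∀ z : Fin n → ℤ, ∀ t ∈ Icc 0 T, (y t ⬝ᵥ fun i => (z i : ℝ)) =
      (y 0 ⬝ᵥ fun i => (z i : ℝ)) + ∫ s in 0..t, y' s ⬝ᵥ fun i => (z i : ℝ) := fun z t ht => by
    have hsub : Icc 0 t ⊆ Icc 0 T := Icc_subset_Icc le_rfl ht.2
    rw [intervalIntegral.integral_eq_sub_of_hasDeriv_right_of_le ht.1 ((hcont z).mono hsub)
      (fun s hs => ((hder z s (hsub ⟨hs.1.le, hs.2.le⟩)).hasDerivAt
        (Icc_mem_nhds hs.1 (hs.2.trans_le ht.2))).hasDerivWithinAt)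
      (((hcont' z).mono hsub).intervalIntegrable_of_Icc ht.1)]
    ring
  -- Product rule for each state separately; the sum over the box is finite.
  have hprod : ∀ z : Fin n → ℤ, P T z * (y T ⬝ᵥ fun i => (z i : ℝ)) =
      P 0 z * (y 0 ⬝ᵥ fun i => (z i : ℝ)) +
        ∫ t in 0..T, (N.masterRHS u (P t) t z * (y t ⬝ᵥ fun i => (z i : ℝ)) +
          P t z * (y' t ⬝ᵥ fun i => (z i : ℝ))) := fun z => by
    rw [← mul_sub_mul_eq_integral_of_primitive hT (f := fun t => P t z)
      (g := fun t => y t ⬝ᵥ fun i => (z i : ℝ)) (h.intervalIntegrable_masterRHS humax hu z 0 T)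
      ((hcont' z).intervalIntegrable_of_Icc hT) (fun t ht => h.master z ht) (hftc z)]
    ring
  have hint : ∀ z : Fin n → ℤ, IntervalIntegrable
      (fun t => N.masterRHS u (P t) t z * (y t ⬝ᵥ fun i => (z i : ℝ)) +
        P t z * (y' t ⬝ᵥ fun i => (z i : ℝ))) volume 0 T := fun z =>
    ((h.intervalIntegrable_masterRHS humax hu z 0 T).mul_continuousOn
      (by rw [uIcc_of_le hT]; exact hcont z)).add
      (((h.continuousOn humax hu z).mul (hcont' z)).intervalIntegrable_of_Icc hT)
  rw [Finset.sum_congr rfl fun z _ => hprod z, Finset.sum_add_distrib,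
    ← intervalIntegral.integral_finsetSum fun z _ => hint z]
  congr 1
  · simp [h.initial, F, cast_mem_populationBox]
  · refine intervalIntegral.integral_congr fun t ht => ?_
    rw [uIcc_of_le hT] at ht
    have := N.sum_mul_masterRHS (u := u) (fun z hz => h.eq_zero_of_notMem humax hu ht hz) t
      (fun z => y t ⬝ᵥ fun i => (z i : ℝ))
    rw [Finset.sum_add_distrib, Finset.sum_congr rfl fun z _ => mul_comm (N.masterRHS u (P t) t z) _,
      this, ← Finset.sum_add_distrib]
    refine Finset.sum_congr rfl fun z _ => ?_
    -- The increment of a linear function under an event does not depend on the state.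
    have hlin : ∀ e, (y t ⬝ᵥ fun i => ((z + N.eventJump e) i : ℝ)) - (y t ⬝ᵥ fun i => (z i : ℝ)) =
        y t ⬝ᵥ fun i => (N.eventJump e i : ℝ) := fun e => by
      simp [dotProduct, mul_add, Finset.sum_add_distrib]
    simp only [hlin]
    ring

end IsForwardSolution

/-! ### Existence by uniformisation -/

namespace QueueNetwork

variable {n mu me : ℕ} (N : QueueNetwork n mu me) {umax : ℝ} {u : Policy n mu}

/-- The uniformised transition rates from `w` to `z`: each event fires at the fixed rate `κ`, and
moves the state only with probability `eventRate / κ`. -/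
noncomputable def uniformRate (u : Policy n mu) (κ : ℝ) (t : ℝ) (z w : Fin n → ℤ) : ℝ :=
  ∑ e, ((if w + N.eventJump e = z then N.eventRate u e w t else 0) +
    (if w = z then κ - N.eventRate u e w t else 0))

variable {κ : ℝ} {M : ℕ}

theorem measurable_uniformRate (hu : IsRegularPolicy umax u) (z w : Fin n → ℤ) :
    Measurable fun t => N.uniformRate u κ t z w := by
  refine Finset.measurable_sum _ fun e _ => Measurable.add ?_ ?_
  · split_ifs
    exacts [N.measurable_eventRate hu e w, measurable_const]
  · split_ifs
    exacts [measurable_const.sub (N.measurable_eventRate hu e w), measurable_const]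

theorem uniformRate_nonneg (hu : IsRegularPolicy umax u) {w : Fin n → ℤ} (hw : 0 ≤ w) {t : ℝ}
    (hκ : ∀ e, N.eventRate u e w t ≤ κ) (z : Fin n → ℤ) : 0 ≤ N.uniformRate u κ t z w := by
  refine Finset.sum_nonneg fun e _ => add_nonneg ?_ ?_
  · split_ifs
    exacts [N.eventRate_nonneg hu e hw t, le_rfl]
  · split_ifs
    exacts [sub_nonneg.2 (hκ e), le_rfl]

theorem uniformRate_le (hu : IsRegularPolicy umax u) {w : Fin n → ℤ} (hw : 0 ≤ w) {t : ℝ}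
    (hκ : ∀ e, N.eventRate u e w t ≤ κ) (z : Fin n → ℤ) :
    N.uniformRate u κ t z w ≤ ∑ _e : Fin me ⊕ Fin mu, (κ + κ) := by
  refine Finset.sum_le_sum fun e _ => ?_
  have h1 := hκ e
  have h2 := N.eventRate_nonneg hu e hw t
  split_ifs <;> linarith

/-- On the box, the uniformised matrix is the generator plus a multiple of the identity. Its
nonnegative entries give a nonnegative Picard series, and an exponential factor removes the
multiple. -/
theorem sum_uniformRate_mul {P : (Fin n → ℤ) → ℝ} (hP : ∀ z, z ∉ populationBox n M → P z = 0)
    (t : ℝ) {z : Fin n → ℤ} (hz : z ∈ populationBox n M) :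
    ∑ w ∈ populationBox n M, N.uniformRate u κ t z w * P w =
      N.masterRHS u P t z + (∑ _e : Fin me ⊕ Fin mu, κ) * P z := by
  simp only [uniformRate, Finset.sum_mul, masterRHS_eq_sum_event]
  rw [Finset.sum_comm, ← Finset.sum_add_distrib]
  refine Finset.sum_congr rfl fun e _ => ?_
  simp only [add_mul, Finset.sum_add_distrib, ite_mul, zero_mul, ← eq_sub_iff_add_eq,
    Finset.sum_ite_eq', hz, if_true]
  split_ifs with h
  · ring
  · rw [hP _ h]
    ring

end QueueNetwork

/-- The master equation has a solution with total mass at most one. -/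
theorem exists_isForwardSolution {n mu me : ℕ} (N : QueueNetwork n mu me) {T umax : ℝ}
    {u : Policy n mu} (humax : 0 ≤ umax) (hu : IsRegularPolicy umax u) (x₀ : Fin n → ℕ) :
    ∃ P, IsForwardSolution N T u x₀ P := by
  set M := ∑ i, x₀ i
  set F := populationBox n M with hF
  -- A single queue holds at most `M` units, so `κ` dominates every event rate in the box.
  set κ : ℝ := ((∑ j, N.γ j) + umax) * M
  set l : ℝ := ∑ _e : Fin me ⊕ Fin mu, κ
  have hγ : 0 ≤ ∑ j, N.γ j := Finset.sum_nonneg fun j _ => N.γ_nonneg j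
  have hκ : ∀ (w : F) t e, N.eventRate u e w t ≤ κ := fun w t e => by
    obtain ⟨h0, hM⟩ := mem_populationBox.1 w.2
    have hi : (w : Fin n → ℤ) (N.eventSrc e) ≤ M :=
      (Finset.single_le_sum (fun j _ => h0 j) (Finset.mem_univ (N.eventSrc e))).trans hM
    refine (le_abs_self _).trans ((N.abs_eventRate_le humax hu e w t).trans ?_)
    rw [abs_of_nonneg (by exact_mod_cast h0 _)]
    exact mul_le_mul_of_nonneg_left (by exact_mod_cast hi) (by positivity)
  have hF0 : ∀ w : F, 0 ≤ (w : Fin n → ℤ) := fun w => (mem_populationBox.1 w.2).1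
  have hQm : ∀ z w : F, Measurable fun t => N.uniformRate u κ t z w := fun z w =>
    N.measurable_uniformRate hu z w
  have hQ0 : ∀ t (z w : F), 0 ≤ N.uniformRate u κ t z w := fun t z w =>
    N.uniformRate_nonneg hu (hF0 w) (hκ w t) z
  have hQ : ∀ t (z w : F), |N.uniformRate u κ t z w| ≤ ∑ _e : Fin me ⊕ Fin mu, (κ + κ) :=
    fun t z w => by
      rw [abs_of_nonneg (hQ0 t z w)]
      exact N.uniformRate_le hu (hF0 w) (hκ w t) z
  obtain ⟨g, hgc, hg0, hg⟩ := exists_nonneg_linear_solution hQm hQ hQ0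
    (p := fun z : F => if (z : Fin n → ℤ) = fun i => (x₀ i : ℤ) then 1 else 0)
    (fun z => by split_ifs <;> simp)
  -- The factor `exp (-l t)` undoes the shift by `l`. Time is cut off at `0` because measurability,
  -- nonnegativity and the mass bound are required at all real times.
  let P : ℝ → (Fin n → ℤ) → ℝ := fun t z =>
    if hz : z ∈ F then Real.exp (-l * max t 0) * g (max t 0) ⟨z, hz⟩ else 0
  have hPF : ∀ t z, z ∉ F → P t z = 0 := fun t z hz => dif_neg hz
  have hPc : ∀ z, Continuous fun t => P t z := fun z => by
    by_cases hz : z ∈ F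
    · simp only [P, hz, dif_pos]
      refine Continuous.mul (by fun_prop) ?_
      exact (hgc ⟨z, hz⟩).comp_continuous (by fun_prop) fun t => le_max_right t 0
    · simp only [hPF _ z hz]
      exact continuous_const
  have hPinit : ∀ z, P 0 z = if z = fun i => (x₀ i : ℤ) then 1 else 0 := fun z => by
    by_cases hz : z ∈ F
    · simp [P, hz, hg 0 le_rfl]
    · rw [hPF 0 z hz, if_neg]
      rintro rfl
      exact hz (IsForwardSolution.cast_mem_populationBox x₀)
  have hPneg : ∀ t z, ¬ 0 ≤ z → P t z = 0 := fun t z hz =>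
    hPF t z fun h => hz (mem_populationBox.1 h).1
  have hPmaster : ∀ t ≥ 0, ∀ z ∈ F, P t z = P 0 z + ∫ s in 0..t, N.masterRHS u (P s) s z := by
    intro t ht z hz
    have hPpos : ∀ s ≥ 0, ∀ w : F, P s w = Real.exp (-l * s) * g s w := fun s hs w => by
      simp [P, max_eq_left hs]
    have hder : ∀ s, HasDerivAt (fun s => Real.exp (-l * s)) (-l * Real.exp (-l * s)) s := fun s => by
      simpa [mul_comm] using ((hasDerivAt_id s).const_mul (-l)).exp
    have hcont' : Continuous fun s => -l * Real.exp (-l * s) := by fun_prop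
    have hprod := mul_sub_mul_eq_integral_of_primitive ht (f := fun s => Real.exp (-l * s))
      (g := fun s => g s ⟨z, hz⟩) (hcont'.intervalIntegrable 0 t)
      (intervalIntegrable_sum_mul hQm hQ ⟨z, hz⟩ fun w =>
        (hgc w).mono (by rw [uIcc_of_le ht]; exact fun s hs => hs.1))
      (fun s _ => by
        rw [intervalIntegral.integral_eq_sub_of_hasDerivAt (fun r _ => hder r)
          (hcont'.intervalIntegrable 0 s)]
        ring)
      (fun s hs => by
        have h0 := hg 0 le_rfl ⟨z, hz⟩
        rw [intervalIntegral.integral_same, add_zero] at h0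
        rw [hg s hs.1, h0])
    rw [← hPpos t ht ⟨z, hz⟩, ← hPpos 0 le_rfl ⟨z, hz⟩, sub_eq_iff_eq_add'] at hprod
    rw [hprod]
    congr 1
    refine intervalIntegral.integral_congr fun s hs => ?_
    rw [uIcc_of_le ht] at hs
    have hsum := N.sum_uniformRate_mul (u := u) (κ := κ) (hPF s) s hz
    rw [← Finset.sum_coe_sort] at hsum
    rw [← sub_eq_iff_eq_add] at hsum
    rw [← hsum, hPpos s hs.1 ⟨z, hz⟩, Finset.mul_sum, ← sub_eq_zero]
    simp only [hPpos s hs.1]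
    rw [Finset.sum_congr rfl fun w _ => mul_left_comm (Real.exp (-l * s)) _ _]
    simp only [l]
    ring
  have hmass : ∀ t ≥ 0, ∑ z ∈ F, P t z = 1 := fun t ht => by
    have hint : ∀ z, IntervalIntegrable (fun s => N.masterRHS u (P s) s z) volume 0 t := fun z => by
      have hrate : ∀ e w, IntervalIntegrable (fun s => N.eventRate u e w s) volume 0 t :=
        fun e w => intervalIntegrable_of_measurable_of_bounded (N.measurable_eventRate hu e w)
          (N.abs_eventRate_le humax hu e w) 0 t
      simp only [QueueNetwork.masterRHS_eq_sum_event]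
      rw [← Finset.sum_fn]
      exact IntervalIntegrable.sum _ fun e _ =>
        ((hrate e _).mul_continuousOn (hPc _).continuousOn).sub
          ((hrate e z).mul_continuousOn (hPc z).continuousOn)
    rw [Finset.sum_congr rfl fun z hz => hPmaster t ht z hz, Finset.sum_add_distrib,
      ← intervalIntegral.integral_finsetSum fun z _ => hint z]
    -- Conservation of mass: the generator kills the constant function `1`.
    have hz : ∀ s, ∑ z ∈ F, N.masterRHS u (P s) s z = 0 := fun s => by
      simpa using N.sum_mul_masterRHS (u := u) (hPF s) s fun _ => 1
    simp only [hz, hPinit]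
    simp [hF, M, IsForwardSolution.cast_mem_populationBox]
  have hPnn : ∀ t z, 0 ≤ P t z := fun t z => by
    simp only [P]
    split_ifs with hz
    exacts [mul_nonneg (Real.exp_nonneg _) (hg0 _ (le_max_right t 0) _), le_rfl]
  have hPmax : ∀ t z, P t z = P (max t 0) z := fun t z => by simp [P]
  refine ⟨P, fun z => (hPc z).measurable, hPnn, fun t s => ?_, hPneg, hPinit, fun z hz t ht => ?_⟩
  · classical
    rw [← hmass (max t 0) (le_max_right t 0), Finset.sum_congr rfl fun z _ => hPmax t z]
    calc ∑ z ∈ s, P (max t 0) z ≤ ∑ z ∈ s ∪ F, P (max t 0) z :=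
          Finset.sum_le_sum_of_subset_of_nonneg Finset.subset_union_left fun z _ _ => hPnn _ z
      _ = ∑ z ∈ F, P (max t 0) z :=
          (Finset.sum_subset Finset.subset_union_right fun z _ hz => hPF _ z hz).symm
  · by_cases hzF : z ∈ F
    · exact hPmaster t ht.1 z hzF
    -- The box is closed under events of nonzero rate, so nothing flows to a state outside it.
    · have : ∀ s, N.masterRHS u (P s) s z = 0 := fun s => by
        rw [QueueNetwork.masterRHS_eq_sum_event]
        refine Finset.sum_eq_zero fun e _ => ?_
        rw [hPF s z hzF, mul_zero, sub_zero]
        by_contra hne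
        have hmem : z - N.eventJump e ∈ F := by
          by_contra hn
          exact hne (by rw [hPF s _ hn, mul_zero])
        have := N.add_eventJump_mem_populationBox hmem
          (N.src_ne_zero_of_eventRate_ne_zero (left_ne_zero_of_mul hne))
        rw [sub_add_cancel] at this
        exact hzF this
      simp [this, hPF _ z hzF]

/-! ### Realisations by measurable processes -/

section Realisation

variable {n mu me : ℕ} {N : QueueNetwork n mu me} {T umax : ℝ} {u : Policy n mu}
  {x₀ : Fin n → ℕ} {P : ℝ → (Fin n → ℤ) → ℝ} {Ω : Type*} [MeasurableSpace Ω] {ℙ : Measure Ω}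
  {X : ℝ → Ω → Fin n → ℕ}

theorem stateProb_eq_zero_of_not_nonneg (t : ℝ) {z : Fin n → ℤ} (hz : ¬ 0 ≤ z) :
    stateProb ℙ X t z = 0 := by
  have : {ω | ∀ i, (X t ω i : ℤ) = z i} = ∅ := by
    ext ω
    simp only [mem_ofPred_eq, mem_empty_iff_false, iff_false]
    intro h
    exact hz fun i => by rw [← h i]; simp
  simp [stateProb, this]

theorem stateProb_natCast (t : ℝ) (x : Fin n → ℕ) :
    stateProb ℙ X t (fun i => (x i : ℤ)) = ℙ.real (X t ⁻¹' {x}) := by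
  simp only [stateProb, Nat.cast_inj]
  congr 1
  ext ω
  exact funext_iff.symm

theorem exists_natCast_eq {z : Fin n → ℤ} (hz : 0 ≤ z) : ∃ x : Fin n → ℕ, (fun i => (x i : ℤ)) = z :=
  ⟨fun i => (z i).toNat, funext fun i => Int.toNat_of_nonneg (hz i)⟩

/-- The marginal laws given by a solution of the master equation, as a kernel. -/
noncomputable def IsForwardSolution.kernel (h : IsForwardSolution N T u x₀ P) :
    ProbabilityTheory.Kernel (Icc 0 T) (Fin n → ℕ) where
  toFun t := ∑ z ∈ populationBox n (∑ i, x₀ i),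
    ENNReal.ofReal (P t z) • Measure.dirac fun i => (z i).toNat
  measurable' := by
    refine Measure.measurable_of_measurable_coe _ fun s _ => ?_
    simp only [Measure.coe_finsetSum, Finset.sum_apply, Measure.smul_apply, smul_eq_mul]
    exact Finset.measurable_sum _ fun z _ =>
      (((h.measurable z).comp measurable_subtype_coe).ennreal_ofReal).mul_const _

theorem IsForwardSolution.kernel_apply (h : IsForwardSolution N T u x₀ P) (t : Icc 0 T) :
    h.kernel t = ∑ z ∈ populationBox n (∑ i, x₀ i),
      ENNReal.ofReal (P t z) • Measure.dirac fun i => (z i).toNat := rfl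

theorem IsForwardSolution.isMarkovKernel (humax : 0 ≤ umax) (hu : IsRegularPolicy umax u)
    (h : IsForwardSolution N T u x₀ P) : ProbabilityTheory.IsMarkovKernel h.kernel := by
  refine ⟨fun t => ⟨?_⟩⟩
  simp only [h.kernel_apply, Measure.coe_finsetSum, Finset.sum_apply, Measure.smul_apply,
    smul_eq_mul, measure_univ, mul_one]
  rw [← ENNReal.ofReal_sum_of_nonneg fun z _ => h.nonneg t z, h.sum_eq_one humax hu t.2]
  simp

theorem IsForwardSolution.kernel_real_singleton (humax : 0 ≤ umax) (hu : IsRegularPolicy umax u)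
    (h : IsForwardSolution N T u x₀ P) (t : Icc 0 T) (x : Fin n → ℕ) :
    (h.kernel t).real {x} = P t fun i => (x i : ℤ) := by
  have hz : ∀ z ∈ populationBox n (∑ i, x₀ i), ENNReal.ofReal (P t z) *
      Measure.dirac (fun i => (z i).toNat) {x} =
      if z = (fun i => (x i : ℤ)) then ENNReal.ofReal (P t z) else 0 := fun z hz => by
    have hz0 := (mem_populationBox.1 hz).1
    obtain ⟨x', rfl⟩ := exists_natCast_eq hz0
    rw [Measure.dirac_apply' _ (measurableSet_singleton x)]
    by_cases hx : x' = x
    · simp [hx]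
    · have : ¬ (fun i => (x' i : ℤ)) = fun i => (x i : ℤ) := fun h =>
        hx (funext fun i => by simpa using congrFun h i)
      simp [hx, this]
  rw [measureReal_def, h.kernel_apply]
  simp only [Measure.coe_finsetSum, Finset.sum_apply, Measure.smul_apply, smul_eq_mul]
  rw [Finset.sum_congr rfl hz, Finset.sum_ite_eq']
  split_ifs with hmem
  · exact ENNReal.toReal_ofReal (h.nonneg t _)
  · rw [h.eq_zero_of_notMem humax hu t.2 hmem]
    simp

/-- A solution of the master equation is realised by a measurable process. -/
theorem IsForwardSolution.exists_realisation (hT : 0 ≤ T) (humax : 0 ≤ umax)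
    (hu : IsRegularPolicy umax u) (h : IsForwardSolution N T u x₀ P) :
    ∃ (Ω : Type w) (_ : MeasurableSpace Ω) (ℙ : Measure Ω) (X : ℝ → Ω → Fin n → ℕ),
      IsProbabilityMeasure ℙ ∧ IsNetworkProcess N T u x₀ ℙ X := by
  have := h.isMarkovKernel humax hu
  -- A realisation is constrained only through its one-time marginals, so no Markov path
  -- construction is needed: a jointly measurable map from the unit interval with the right law at
  -- each time suffices. `ULift` places it in the required universe.
  obtain ⟨f, hf, hfm⟩ := h.kernel.exists_measurable_map_eq_unitInterval
  let X : ℝ → ULift.{w} unitInterval → Fin n → ℕ := fun t ω => f (projIcc 0 T hT t) ω.down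
  let ℙ : Measure (ULift.{w} unitInterval) := Measure.map ULift.up volume
  have hP : IsProbabilityMeasure ℙ := Measure.isProbabilityMeasure_map measurable_up.aemeasurable
  have hXm : ∀ t, Measurable (X t) := fun t => hf.of_uncurry_left.comp measurable_down
  have hprob : ∀ t ∈ Icc 0 T, ∀ z, stateProb ℙ X t z = P t z := fun t ht z => by
    by_cases hz : 0 ≤ z
    · obtain ⟨x, rfl⟩ := exists_natCast_eq hz
      rw [stateProb_natCast, ← h.kernel_real_singleton humax hu ⟨t, ht⟩ x, ← hfm,
        measureReal_def, measureReal_def,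
        Measure.map_apply measurable_up (hXm t (measurableSet_singleton x)),
        Measure.map_apply hf.of_uncurry_left (measurableSet_singleton x)]
      simp only [X, projIcc_of_mem hT ht]
      rfl
    · rw [stateProb_eq_zero_of_not_nonneg t hz, h.eq_zero_of_not_nonneg t z hz]
  refine ⟨ULift.{w} unitInterval, inferInstance, ℙ, X, hP, ⟨?_, ?_, fun x t ht => ?_⟩⟩
  · simp only [X, projIcc_val]
    exact hf.comp (measurable_fst.prodMk (measurable_down.comp measurable_snd))
  · have h1 := hprob 0 ⟨le_rfl, hT⟩ fun i => (x₀ i : ℤ)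
    rw [h.initial, if_pos rfl, stateProb_natCast, measureReal_def, ENNReal.toReal_eq_one_iff,
      ← mem_ae_iff_prob_eq_one (hXm 0 (measurableSet_singleton x₀))] at h1
    exact h1
  · rw [hprob t ht, hprob 0 ⟨le_rfl, hT⟩, h.master _ ht]
    congr 1
    refine intervalIntegral.integral_congr fun s hs => ?_
    rw [uIcc_of_le ht.1] at hs
    rw [show stateProb ℙ X s = P s from funext fun z => hprob s ⟨hs.1, hs.2.trans ht.2⟩ z]

/-- The process evaluated at the projection of the time to the horizon is measurable. -/
theorem IsNetworkProcess.measurable_projIcc (hT : 0 ≤ T) (hX : IsNetworkProcess N T u x₀ ℙ X) :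
    Measurable fun p : ℝ × Ω => X (projIcc 0 T hT p.1) p.2 :=
  hX.measurable.comp (((continuous_projIcc (h := hT)).measurable.comp measurable_fst).prodMk measurable_snd)

theorem IsNetworkProcess.measurable_apply_projIcc (hT : 0 ≤ T)
    (hX : IsNetworkProcess N T u x₀ ℙ X) (t : ℝ) : Measurable (X (projIcc 0 T hT t)) :=
  (hX.measurable_projIcc hT).comp measurable_prodMk_left

variable [IsProbabilityMeasure ℙ]

theorem measurableSet_natCast_eq {A : Type*} [MeasurableSpace A] {Y : A → Fin n → ℕ}
    (hY : Measurable Y) (z : Fin n → ℤ) : MeasurableSet {a | ∀ i, (Y a i : ℤ) = z i} :=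
  hY (MeasurableSet.of_discrete (s := {x : Fin n → ℕ | ∀ i, (x i : ℤ) = z i}))

/-- Clamping time to the horizon supplies the conditions demanded at all real times; measurability
in time comes from joint measurability of the process. -/
theorem IsNetworkProcess.isForwardSolution (hT : 0 ≤ T) (hX : IsNetworkProcess N T u x₀ ℙ X) :
    IsForwardSolution N T u x₀ fun t z => stateProb ℙ X (projIcc 0 T hT t) z where
  measurable z := by
    have := measurable_measure_prodMk_left (ν := ℙ)
      (measurableSet_natCast_eq (hX.measurable_projIcc hT) z)
    exact this.ennreal_toReal
  nonneg t z := measureReal_nonneg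
  sum_le_one t s := by
    have hm := hX.measurable_apply_projIcc hT t
    simp only [stateProb]
    rw [← measureReal_biUnion_finset]
    · exact measureReal_le_one
    · intro z _ z' _ hzz'
      refine disjoint_left.2 fun ω hω hω' => hzz' ?_
      exact funext fun i => (hω i).symm.trans (hω' i)
    · exact fun z _ => measurableSet_natCast_eq hm z
  eq_zero_of_not_nonneg t z hz := stateProb_eq_zero_of_not_nonneg _ hz
  initial z := by
    have h0 : (projIcc 0 T hT 0 : ℝ) = 0 := by rw [projIcc_left]
    simp only [h0, stateProb]
    have : {ω | ∀ i, (X 0 ω i : ℤ) = z i} =ᵐ[ℙ] {_ω | z = fun i => (x₀ i : ℤ)} := by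
      filter_upwards [hX.initial] with ω hω
      refine propext ⟨fun h => funext fun i => ?_, fun h i => ?_⟩
      · rw [← h i, hω]
      · rw [show z = fun i => (x₀ i : ℤ) from h, hω]
    rw [measureReal_congr this]
    split_ifs with hz
    · simp [hz]
    · simp [hz]
  master_of_nonneg z hz t ht := by
    obtain ⟨x, rfl⟩ := exists_natCast_eq hz
    have hproj : ∀ s ∈ Icc 0 T, (projIcc 0 T hT s : ℝ) = s := fun s hs => by
      rw [projIcc_of_mem hT hs]
    rw [hproj t ht, hproj 0 ⟨le_rfl, hT⟩, hX.master x t ht]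
    congr 1
    refine intervalIntegral.integral_congr fun s hs => ?_
    rw [uIcc_of_le ht.1] at hs
    rw [hproj s ⟨hs.1, hs.2.trans ht.2⟩]

/-- Expectation of a function of the state in terms of the state probabilities. -/
theorem integral_sum_indicator {Y : Ω → Fin n → ℕ} (hY : Measurable Y) (F : Finset (Fin n → ℤ))
    (f : (Fin n → ℤ) → ℝ) :
    Integrable (fun ω => ∑ z ∈ F, {ω | ∀ i, (Y ω i : ℤ) = z i}.indicator (fun _ => f z) ω) ℙ ∧
    ∫ ω, ∑ z ∈ F, {ω | ∀ i, (Y ω i : ℤ) = z i}.indicator (fun _ => f z) ω ∂ℙ =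
      ∑ z ∈ F, ℙ.real {ω | ∀ i, (Y ω i : ℤ) = z i} * f z := by
  have hi : ∀ z, Integrable ({ω | ∀ i, (Y ω i : ℤ) = z i}.indicator fun _ => f z) ℙ := fun z =>
    (integrable_const _).indicator (measurableSet_natCast_eq hY z)
  refine ⟨integrable_finsetSum _ fun z _ => hi z, ?_⟩
  rw [integral_finsetSum _ fun z _ => hi z]
  refine Finset.sum_congr rfl fun z _ => ?_
  rw [integral_indicator (measurableSet_natCast_eq hY z)]
  simp

/-- On the box, a function of the state is a finite sum of indicators, so its mean is a finite sum
of state probabilities. -/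
theorem sum_indicator_eq {A : Type*} {Y : A → Fin n → ℕ} {F : Finset (Fin n → ℤ)}
    (f : (Fin n → ℕ) → ℝ) {a : A}
    (ha : (fun i => (Y a i : ℤ)) ∈ F) :
    ∑ z ∈ F, {ω | ∀ i, (Y ω i : ℤ) = z i}.indicator (fun _ => f fun i => (z i).toNat) a =
      f (Y a) := by
  rw [Finset.sum_eq_single_of_mem _ ha]
  · rw [indicator_of_mem (by simp)]
    simp
  · intro z _ hz
    refine indicator_of_notMem ?_ _
    intro h
    exact hz (funext fun i => (h i).symm)

theorem IsNetworkProcess.ae_mem_populationBox (hT : 0 ≤ T) (humax : 0 ≤ umax)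
    (hu : IsRegularPolicy umax u) (hX : IsNetworkProcess N T u x₀ ℙ X) (t : ℝ) :
    ∀ᵐ ω ∂ℙ, (fun i => (X (projIcc 0 T hT t) ω i : ℤ)) ∈ populationBox n (∑ i, x₀ i) := by
  have hm := hX.measurable_apply_projIcc hT t
  have hFS := hX.isForwardSolution hT
  have h1 := hFS.sum_eq_one humax hu (projIcc 0 T hT t).2
  simp only [stateProb, projIcc_val] at h1
  rw [← measureReal_biUnion_finset] at h1
  · rw [measureReal_def, ENNReal.toReal_eq_one_iff, ← mem_ae_iff_prob_eq_one
      (Finset.measurableSet_biUnion _ fun z _ => measurableSet_natCast_eq hm z)] at h1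
    filter_upwards [h1] with ω hω
    simp only [mem_iUnion] at hω
    obtain ⟨z, hz, hzω⟩ := hω
    rwa [show (fun i => (X (projIcc 0 T hT t) ω i : ℤ)) = z from funext hzω]
  · intro z _ z' _ hzz'
    refine disjoint_left.2 fun ω hω hω' => hzz' ?_
    exact funext fun i => (hω i).symm.trans (hω' i)
  · exact fun z _ => measurableSet_natCast_eq hm z

end Realisation

/-! ### The expected cost as a function of the marginals -/

section Cost

variable {n mu me : ℕ} {N : QueueNetwork n mu me} {q c : Fin n → ℝ} {v : Fin mu → ℝ}
  {T umax : ℝ} {u : Policy n mu} {x₀ : Fin n → ℕ}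

theorem stageCost_eq (x : Fin n → ℕ) (t : ℝ) :
    stageCost N q v u x t =
      (q ⬝ᵥ fun i => (x i : ℝ)) + ∑ k, v k * (u x t k * (x (N.src k) : ℝ)) := by
  have hH : N.H *ᵥ (fun i => (x i : ℝ)) = fun k => (x (N.src k) : ℝ) := by
    ext k
    simp [Matrix.mulVec, dotProduct, QueueNetwork.H]
  rw [stageCost, ← Matrix.mulVec_mulVec, hH]
  simp only [dotProduct, Matrix.mulVec_diagonal]

theorem measurable_stageCost (hu : IsRegularPolicy umax u) (x : Fin n → ℕ) :
    Measurable (stageCost N q v u x) := by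
  simp only [funext (stageCost_eq (N := N) (q := q) (v := v) (u := u) x)]
  exact measurable_const.add (Finset.measurable_sum _ fun k _ =>
    (((hu x k).1.mul_const _).const_mul _))

theorem abs_stageCost_le (hu : IsRegularPolicy umax u) (x : Fin n → ℕ) (t : ℝ) :
    |stageCost N q v u x t| ≤
      |q ⬝ᵥ fun i => (x i : ℝ)| + ∑ k, |v k| * (umax * (x (N.src k) : ℝ)) := by
  rw [stageCost_eq]
  refine (abs_add_le _ _).trans (add_le_add le_rfl ((Finset.abs_sum_le_sum_abs _ _).trans
    (Finset.sum_le_sum fun k _ => ?_)))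
  rw [abs_mul, abs_mul, abs_of_nonneg ((hu x k).2 t).1, Nat.abs_cast]
  have := ((hu x k).2 t).2
  gcongr

/-- The expected cost in terms of the state probabilities `P`, carried by the box of size `M`. -/
noncomputable def meanCost (N : QueueNetwork n mu me) (q : Fin n → ℝ) (v : Fin mu → ℝ)
    (c : Fin n → ℝ) (T : ℝ) (u : Policy n mu) (M : ℕ) (P : ℝ → (Fin n → ℤ) → ℝ) : ℝ :=
  ∑ z ∈ populationBox n M, P T z * (c ⬝ᵥ fun i => ((z i).toNat : ℝ)) +
    ∫ t in 0..T, ∑ z ∈ populationBox n M, P t z * stageCost N q v u (fun i => (z i).toNat) t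

theorem meanCost_congr (hT : 0 ≤ T) {M : ℕ} {P P' : ℝ → (Fin n → ℤ) → ℝ}
    (h : ∀ t ∈ Icc 0 T, ∀ z, P t z = P' t z) :
    meanCost N q v c T u M P = meanCost N q v c T u M P' := by
  rw [meanCost, meanCost]
  congr 1
  · exact Finset.sum_congr rfl fun z _ => by rw [h T ⟨hT, le_rfl⟩]
  · refine intervalIntegral.integral_congr fun t ht => ?_
    rw [uIcc_of_le hT] at ht
    exact Finset.sum_congr rfl fun z _ => by rw [h t ht]

variable {Ω : Type*} [MeasurableSpace Ω] {ℙ : Measure Ω} [IsProbabilityMeasure ℙ]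
  {X : ℝ → Ω → Fin n → ℕ}

/-- Fubini exchanges expectation and time integral, after which only the law at each single time
matters. -/
theorem IsNetworkProcess.integral_pathCost (hT : 0 ≤ T) (humax : 0 ≤ umax)
    (hu : IsRegularPolicy umax u) (hX : IsNetworkProcess N T u x₀ ℙ X) :
    (∀ᵐ ω ∂ℙ, IntervalIntegrable (fun t => stageCost N q v u (X t ω) t) volume 0 T) ∧
    Integrable (fun ω => pathCost N q v c T u fun t => X t ω) ℙ ∧
    ∫ ω, pathCost N q v c T u (fun t => X t ω) ∂ℙ =
      meanCost N q v c T u (∑ i, x₀ i) fun t z => stateProb ℙ X (projIcc 0 T hT t) z := by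
  set F := populationBox n (∑ i, x₀ i) with hF
  have hmem := hX.ae_mem_populationBox hT humax hu
  have hproj : ∀ t ∈ Icc 0 T, (projIcc 0 T hT t : ℝ) = t := fun t ht => by
    rw [projIcc_of_mem hT ht]
  -- The stage cost is unbounded in the state; its restriction to the box is bounded and jointly
  -- measurable.
  let φ : ℝ × Ω → ℝ := fun p => ∑ z ∈ F,
    {ω | ∀ i, (X (projIcc 0 T hT p.1) ω i : ℤ) = z i}.indicator
      (fun _ => stageCost N q v u (fun i => (z i).toNat) p.1) p.2
  let τ : Measure ℝ := volume.restrict (Ioc 0 T)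
  have hφ : Integrable φ (τ.prod ℙ) := by
    refine integrable_finsetSum _ fun z _ => ?_
    have hset := measurableSet_natCast_eq (hX.measurable_projIcc hT) z
    have hconst : Integrable
        (fun p : ℝ × Ω => stageCost N q v u (fun i => (z i).toNat) p.1) (τ.prod ℙ) :=
      Integrable.of_bound ((measurable_stageCost hu _).comp measurable_fst).aestronglyMeasurable _
        (Filter.Eventually.of_forall fun p => abs_stageCost_le hu _ p.1)
    exact hconst.indicator hset
  have hboxm : MeasurableSet
      {p : ℝ × Ω | (fun i => (X (projIcc 0 T hT p.1) p.2 i : ℤ)) ∈ F} :=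
    (hX.measurable_projIcc hT) (MeasurableSet.of_discrete
      (s := {x : Fin n → ℕ | (fun i => (x i : ℤ)) ∈ F}))
  -- The null set on which the process leaves the box may depend on the time; Fubini makes the
  -- statement hold for almost every path at almost every time.
  have hswap : ∀ᵐ ω ∂ℙ, ∀ᵐ t ∂τ, (fun i => (X (projIcc 0 T hT t) ω i : ℤ)) ∈ F :=
    (Measure.ae_ae_comm hboxm).1 (Filter.Eventually.of_forall hmem)
  have hcost : ∀ᵐ ω ∂ℙ, (fun t => φ (t, ω)) =ᵐ[τ] fun t => stageCost N q v u (X t ω) t := by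
    filter_upwards [hswap] with ω hω
    filter_upwards [hω, ae_restrict_mem measurableSet_Ioc] with t ht htI
    have h := sum_indicator_eq (Y := X (projIcc 0 T hT t))
      (fun x => stageCost N q v u x t) ht
    simp only [φ]
    rw [h, hproj t ⟨htI.1.le, htI.2⟩]
  have hint : ∀ᵐ ω ∂ℙ, ∫ t in 0..T, stageCost N q v u (X t ω) t = ∫ t, φ (t, ω) ∂τ := by
    filter_upwards [hcost] with ω hω
    rw [intervalIntegral.integral_of_le hT]
    exact (integral_congr_ae hω).symm
  have hterm : ∀ᵐ ω ∂ℙ, (c ⬝ᵥ fun i => (X T ω i : ℝ)) = ∑ z ∈ F,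
      {ω | ∀ i, (X T ω i : ℤ) = z i}.indicator
        (fun _ => c ⬝ᵥ fun i => ((z i).toNat : ℝ)) ω := by
    filter_upwards [hmem T] with ω hω
    rw [hproj T ⟨hT, le_rfl⟩] at hω
    exact (sum_indicator_eq (Y := X T) (fun x => c ⬝ᵥ fun i => (x i : ℝ)) hω).symm
  have hXT : Measurable (X T) := by
    simpa only [hproj T ⟨hT, le_rfl⟩] using hX.measurable_apply_projIcc hT T
  obtain ⟨hT1, hT2⟩ := integral_sum_indicator (ℙ := ℙ) hXT F
    fun z => c ⬝ᵥ fun i => ((z i).toNat : ℝ)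
  have hpath : (fun ω => pathCost N q v c T u fun t => X t ω) =ᵐ[ℙ] fun ω =>
      (∑ z ∈ F, {ω | ∀ i, (X T ω i : ℤ) = z i}.indicator
        (fun _ => c ⬝ᵥ fun i => ((z i).toNat : ℝ)) ω) + ∫ t, φ (t, ω) ∂τ := by
    filter_upwards [hint, hterm] with ω h1 h2
    rw [pathCost, h1, h2]
  refine ⟨?_, ?_, ?_⟩
  · filter_upwards [hcost, hφ.prod_left_ae] with ω h1 h2
    rw [intervalIntegrable_iff_integrableOn_Ioc_of_le hT]
    exact h2.congr h1
  · exact (hT1.add hφ.integral_prod_right).congr hpath.symm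
  · rw [integral_congr_ae hpath, integral_add hT1 hφ.integral_prod_right, hT2, meanCost]
    congr 1
    · simp only [stateProb, hproj T ⟨hT, le_rfl⟩, hF]
    · rw [← integral_integral_swap hφ, intervalIntegral.integral_of_le hT]
      refine integral_congr_ae (Filter.Eventually.of_forall fun t => ?_)
      exact (integral_sum_indicator (ℙ := ℙ) (hX.measurable_apply_projIcc hT t) F
        fun z => stageCost N q v u (fun i => (z i).toNat) t).2

end Cost

/-! ### Well-defined costs and the Hamiltonian -/

section Value

variable {n mu me : ℕ} {N : QueueNetwork n mu me} {q c : Fin n → ℝ} {v : Fin mu → ℝ}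
  {T umax s₀ : ℝ} {u u' : Policy n mu} {x₀ : Fin n → ℕ} {P : ℝ → (Fin n → ℤ) → ℝ}

theorem IsForwardSolution.hasCost (hT : 0 ≤ T) (humax : 0 ≤ umax) (hu : IsRegularPolicy umax u)
    (h : IsForwardSolution N T u x₀ P) :
    HasCost.{w} N q v c T u x₀ (meanCost N q v c T u (∑ i, x₀ i) P) := by
  refine ⟨h.exists_realisation hT humax hu, fun Ω _ ℙ X hℙ hX => ?_⟩
  have := hX.integral_pathCost (q := q) (v := v) (c := c) hT humax hu
  refine ⟨this.1, this.2.1, this.2.2.trans (meanCost_congr hT fun t ht z => ?_)⟩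
  exact (hX.isForwardSolution hT).unique humax hu h ht z

/-- At least one realisation exists, and its mean cost is both values. -/
theorem HasCost.unique {a a' : ℝ} (h : HasCost.{w} N q v c T u x₀ a)
    (h' : HasCost.{w} N q v c T u x₀ a') : a = a' := by
  obtain ⟨Ω, mΩ, ℙ, X, hℙ, hX⟩ := h.1
  rw [← (h.2 Ω mΩ ℙ X hℙ hX).2.2, (h'.2 Ω mΩ ℙ X hℙ hX).2.2]

theorem IsNetworkProcess.congr (huu' : ∀ x, ∀ t ∈ Icc 0 T, u x t = u' x t) {Ω : Type*}
    [MeasurableSpace Ω] {ℙ : Measure Ω} {X : ℝ → Ω → Fin n → ℕ}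
    (hX : IsNetworkProcess N T u x₀ ℙ X) : IsNetworkProcess N T u' x₀ ℙ X where
  measurable := hX.measurable
  initial := hX.initial
  master x t ht := by
    rw [hX.master x t ht]
    congr 1
    refine intervalIntegral.integral_congr fun s hs => ?_
    rw [uIcc_of_le ht.1] at hs
    simp only [QueueNetwork.masterRHS, QueueNetwork.routeRate,
      huu' _ s ⟨hs.1, hs.2.trans ht.2⟩]

theorem HasCost.congr (hT : 0 ≤ T) (huu' : ∀ x, ∀ t ∈ Icc 0 T, u x t = u' x t) {a : ℝ}
    (h : HasCost.{w} N q v c T u x₀ a) : HasCost.{w} N q v c T u' x₀ a := by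
  have hstage : ∀ x, ∀ t ∈ Icc 0 T, stageCost N q v u x t = stageCost N q v u' x t :=
    fun x t ht => by rw [stageCost, stageCost, huu' x t ht]
  have hpath : ∀ ξ : ℝ → Fin n → ℕ, pathCost N q v c T u ξ = pathCost N q v c T u' ξ :=
    fun ξ => by
      rw [pathCost, pathCost]
      congr 1
      refine intervalIntegral.integral_congr fun t ht => ?_
      rw [uIcc_of_le hT] at ht
      exact hstage _ t ht
  obtain ⟨⟨Ω, mΩ, ℙ, X, hℙ, hX⟩, h2⟩ := h
  refine ⟨⟨Ω, mΩ, ℙ, X, hℙ, hX.congr huu'⟩, fun Ω mΩ ℙ X hℙ hX => ?_⟩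
  obtain ⟨hi, hint, heq⟩ := h2 Ω mΩ ℙ X hℙ (hX.congr fun x t ht => (huu' x t ht).symm)
  simp only [hpath] at hint heq
  refine ⟨?_, hint, heq⟩
  filter_upwards [hi] with ω hω
  refine hω.congr_ae ?_
  filter_upwards [ae_restrict_mem measurableSet_uIoc] with t ht
  rw [uIoc_of_le hT] at ht
  exact hstage _ t ⟨ht.1.le, ht.2⟩

/-- The vector `yᵀ R_E Γ E` applied to a state. -/
theorem QueueNetwork.vecMul_exit_dotProduct (N : QueueNetwork n mu me) (y ξ : Fin n → ℝ) :
    y ᵥ* (N.RE * N.Gam * N.E) ⬝ᵥ ξ =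
      ∑ j, N.γ j * ξ (N.exitAt j) * (y ⬝ᵥ fun i => (N.exitJump j i : ℝ)) := by
  rw [← Matrix.vecMul_vecMul, ← Matrix.vecMul_vecMul, ← Matrix.dotProduct_mulVec]
  simp only [QueueNetwork.Gam, dotProduct, Matrix.vecMul_diagonal]
  refine Finset.sum_congr rfl fun j _ => ?_
  simp only [Matrix.vecMul, Matrix.mulVec, dotProduct, QueueNetwork.E, QueueNetwork.RE,
    Matrix.of_apply, ite_mul, one_mul, zero_mul, Finset.sum_ite_eq', Finset.mem_univ, if_true]
  ring

theorem QueueNetwork.vecMul_H_dotProduct (N : QueueNetwork n mu me) (a : Fin mu → ℝ)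
    (ξ : Fin n → ℝ) : a ᵥ* N.H ⬝ᵥ ξ = ∑ k, a k * ξ (N.src k) := by
  rw [← Matrix.dotProduct_mulVec]
  simp [dotProduct, Matrix.mulVec, QueueNetwork.H]

/-- The derivative of the value along a policy, plus the stage cost, is the excess of the
Hamiltonian at the policy over its minimum. -/
theorem hamiltonian_gap {y y' : Fin n → ℝ} {z : Fin n → ℤ} (hz : 0 ≤ z) (t : ℝ)
    (hy : y' + q + y ᵥ* (N.RE * N.Gam * N.E) +
      (umax / 2) • (((y ᵥ* N.RD + v) - fun k => |(y ᵥ* N.RD + v) k|) ᵥ* N.H) = 0) :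
    (y' ⬝ᵥ fun i => (z i : ℝ)) +
        ∑ e, N.eventRate u e z t * (y ⬝ᵥ fun i => (N.eventJump e i : ℝ)) +
        stageCost N q v u (fun i => (z i).toNat) t =
      ∑ k, (u (fun i => (z i).toNat) t k * (y ᵥ* N.RD + v) k -
        umax / 2 * ((y ᵥ* N.RD + v) k - |(y ᵥ* N.RD + v) k|)) * (z (N.src k) : ℝ) := by
  have hcast : ∀ i, (((z i).toNat : ℕ) : ℝ) = (z i : ℝ) := fun i => by
    exact_mod_cast congrArg (Int.cast (R := ℝ)) (Int.toNat_of_nonneg (hz i))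
  -- The backward equation is paired with the state; its exit terms cancel those of the generator,
  -- which leaves the routing terms.
  have h := congrArg (fun r => r ⬝ᵥ fun i => (z i : ℝ)) hy
  simp only [add_dotProduct, smul_dotProduct, N.vecMul_exit_dotProduct, N.vecMul_H_dotProduct,
    zero_dotProduct, smul_eq_mul] at h
  have hRD : ∀ k, (y ⬝ᵥ fun i => (N.routeJump k i : ℝ)) = (y ᵥ* N.RD) k := fun k => rfl
  rw [stageCost_eq, Fintype.sum_sum_type]
  simp only [QueueNetwork.eventRate, QueueNetwork.unitRate, QueueNetwork.eventJump,
    QueueNetwork.eventSrc, Sum.elim_inl, Sum.elim_inr, hcast, hRD]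
  set a := y ᵥ* N.RD + v with ha
  have hsum : ∑ k, (u (fun i => (z i).toNat) t k * a k - umax / 2 * (a k - |a k|)) *
      (z (N.src k) : ℝ) =
      ∑ k, u (fun i => (z i).toNat) t k * (z (N.src k) : ℝ) * (y ᵥ* N.RD) k +
      ∑ k, v k * (u (fun i => (z i).toNat) t k * (z (N.src k) : ℝ)) -
      umax / 2 * ∑ k, (a k - |a k|) * (z (N.src k) : ℝ) := by
    rw [Finset.mul_sum, ← Finset.sum_add_distrib, ← Finset.sum_sub_distrib]
    refine Finset.sum_congr rfl fun k _ => ?_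
    rw [show (y ᵥ* N.RD) k = a k - v k by simp [ha]]
    ring
  rw [hsum]
  simp only [Pi.sub_apply] at h
  linarith

end Value

/-! ### Verification and optimality -/

section Verification

variable {n mu me : ℕ} {N : QueueNetwork n mu me} {q c : Fin n → ℝ} {v : Fin mu → ℝ}
  {T umax s₀ : ℝ} {u : Policy n mu} {x₀ : Fin n → ℕ} {P : ℝ → (Fin n → ℤ) → ℝ}
  {y : ℝ → Fin n → ℝ}

theorem SolvesBackward.continuousOn (hy : SolvesBackward N q v c umax T y) :
    ContinuousOn y (Icc 0 T) := by
  obtain ⟨-, y', h⟩ := hy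
  exact fun t ht => (h t ht).1.continuousWithinAt

/-- Verification: the expected cost exceeds `y(0)ᵀ x₀` by the accumulated excess of the
Hamiltonian at the policy over its minimum. -/
theorem SolvesBackward.meanCost_eq (hT : 0 ≤ T) (humax : 0 ≤ umax)
    (hy : SolvesBackward N q v c umax T y) (hu : IsRegularPolicy umax u)
    (h : IsForwardSolution N T u x₀ P) :
    meanCost N q v c T u (∑ i, x₀ i) P = (y 0 ⬝ᵥ fun i => (x₀ i : ℝ)) +
      ∫ t in 0..T, ∑ z ∈ populationBox n (∑ i, x₀ i), P t z *
        ∑ k, (u (fun i => (z i).toNat) t k * (y t ᵥ* N.RD + v) k -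
          umax / 2 * ((y t ᵥ* N.RD + v) k - |(y t ᵥ* N.RD + v) k|)) * (z (N.src k) : ℝ) := by
  have hyc := hy.continuousOn
  obtain ⟨hyT, y', hy'⟩ := hy
  -- The equation expresses `y'` continuously through `y`, so `y` is continuously differentiable on
  -- the horizon, as Dynkin's formula requires.
  have hy'eq : ∀ t ∈ Icc 0 T, y' t = -(q + y t ᵥ* (N.RE * N.Gam * N.E) + (umax / 2) •
      (((y t ᵥ* N.RD + v) - fun k => |(y t ᵥ* N.RD + v) k|) ᵥ* N.H)) := fun t ht => by
    rw [eq_neg_iff_add_eq_zero, ← (hy' t ht).2]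
    abel
  have hvm : ∀ {m : ℕ} (A : Matrix (Fin n) (Fin m) ℝ),
      ContinuousOn (fun t => y t ᵥ* A) (Icc 0 T) := fun A =>
    (Continuous.matrix_vecMul continuous_id continuous_const).comp_continuousOn hyc
  have hac : ContinuousOn (fun t => y t ᵥ* N.RD + v) (Icc 0 T) :=
    (hvm N.RD).add continuousOn_const
  have hy'c : ContinuousOn y' (Icc 0 T) := by
    refine ContinuousOn.congr ?_ hy'eq
    refine ((continuousOn_const.add (hvm _)).add (ContinuousOn.const_smul ?_ (umax / 2))).neg
    exact (Continuous.matrix_vecMul continuous_id continuous_const).comp_continuousOn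
      (hac.sub (continuousOn_pi.2 fun k => (continuousOn_pi.1 hac k).abs))
  have hdyn := h.dynkin hT humax hu (fun t ht => (hy' t ht).1) hy'c
  have hdot : ∀ (f : ℝ → Fin n → ℝ), ContinuousOn f (Icc 0 T) → ∀ r : Fin n → ℝ,
      ContinuousOn (fun t => f t ⬝ᵥ r) (Icc 0 T) := fun f hf r => by
    simp only [dotProduct]
    exact continuousOn_finsetSum _ fun i _ => (continuousOn_pi.1 hf i).mul continuousOn_const
  have hcast : ∀ z ∈ populationBox n (∑ i, x₀ i), (fun i => ((z i).toNat : ℝ)) =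
      fun i => (z i : ℝ) := fun z hz => funext fun i => by
    exact_mod_cast congrArg (Int.cast (R := ℝ)) (Int.toNat_of_nonneg ((mem_populationBox.1 hz).1 i))
  have hA : IntervalIntegrable (fun t => ∑ z ∈ populationBox n (∑ i, x₀ i),
        P t z * ((y' t ⬝ᵥ fun i => (z i : ℝ)) +
          ∑ e, N.eventRate u e z t * (y t ⬝ᵥ fun i => (N.eventJump e i : ℝ)))) volume 0 T := by
    rw [← Finset.sum_fn]
    refine IntervalIntegrable.sum _ fun z _ => IntervalIntegrable.continuousOn_mul
      (((hdot y' hy'c _).intervalIntegrable_of_Icc hT).add ?_)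
      (by rw [uIcc_of_le hT]; exact h.continuousOn humax hu z)
    rw [← Finset.sum_fn]
    exact IntervalIntegrable.sum _ fun e _ =>
      (intervalIntegrable_of_measurable_of_bounded (N.measurable_eventRate hu e z)
        (N.abs_eventRate_le humax hu e z) 0 T).mul_continuousOn
        (by rw [uIcc_of_le hT]; exact hdot y hyc _)
  have hB : IntervalIntegrable (fun t => ∑ z ∈ populationBox n (∑ i, x₀ i),
      P t z * stageCost N q v u (fun i => (z i).toNat) t) volume 0 T := by
    rw [← Finset.sum_fn]
    exact IntervalIntegrable.sum _ fun z _ =>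
      (intervalIntegrable_of_measurable_of_bounded (measurable_stageCost hu _)
        (abs_stageCost_le hu _) 0 T).continuousOn_mul
        (by rw [uIcc_of_le hT]; exact h.continuousOn humax hu z)
  rw [meanCost, Finset.sum_congr rfl fun z hz => by rw [hcast z hz, ← hyT], hdyn, add_assoc,
    ← intervalIntegral.integral_add hA hB]
  congr 1
  refine intervalIntegral.integral_congr fun t ht => ?_
  rw [uIcc_of_le hT] at ht
  rw [← Finset.sum_add_distrib]
  refine Finset.sum_congr rfl fun z hz => ?_
  rw [← mul_add, hamiltonian_gap (mem_populationBox.1 hz).1 t (hy' t ht).2]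

/-- The left side is `b * min a 0`, the minimum of `r * a` over `r ∈ [0, b]`. -/
theorem half_mul_sub_abs_le {b r : ℝ} (hr : r ∈ Icc 0 b) (a : ℝ) :
    b / 2 * (a - |a|) ≤ r * a := by
  rcases le_total 0 a with ha | ha
  · rw [abs_of_nonneg ha, sub_self, mul_zero]
    exact mul_nonneg hr.1 ha
  · rw [abs_of_nonpos ha]
    linarith [mul_le_mul_of_nonpos_right hr.2 ha]

/-- At `a = 0` both sides vanish whatever `s₀` is, so the convention for the sign at zero does not
affect the cost. -/
theorem one_sub_sgn_mul (s₀ a : ℝ) : (1 - sgn s₀ a) * a = a - |a| := by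
  rcases lt_trichotomy a 0 with ha | rfl | ha
  · rw [sgn, if_neg ha.not_gt, if_pos ha, abs_of_neg ha]
    ring
  · simp
  · rw [sgn, if_pos ha, abs_of_pos ha]
    ring

theorem SolvesBackward.le_meanCost (hT : 0 ≤ T) (humax : 0 ≤ umax)
    (hy : SolvesBackward N q v c umax T y) (hu : IsRegularPolicy umax u)
    (h : IsForwardSolution N T u x₀ P) :
    (y 0 ⬝ᵥ fun i => (x₀ i : ℝ)) ≤ meanCost N q v c T u (∑ i, x₀ i) P := by
  rw [hy.meanCost_eq hT humax hu h]
  refine le_add_of_nonneg_right (intervalIntegral.integral_nonneg hT fun t _ =>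
    Finset.sum_nonneg fun z hz => mul_nonneg (h.nonneg t z) (Finset.sum_nonneg fun k _ =>
      mul_nonneg (sub_nonneg.2 (half_mul_sub_abs_le ((hu _ k).2 t) _)) ?_))
  exact_mod_cast (mem_populationBox.1 hz).1 (N.src k)

theorem SolvesBackward.meanCost_bangBang (hT : 0 ≤ T) (humax : 0 ≤ umax)
    (hy : SolvesBackward N q v c umax T y) (hu : IsRegularPolicy umax u)
    (hbang : ∀ x, ∀ t ∈ Icc 0 T, u x t = bangBang N v umax s₀ y x t)
    (h : IsForwardSolution N T u x₀ P) :
    meanCost N q v c T u (∑ i, x₀ i) P = y 0 ⬝ᵥ fun i => (x₀ i : ℝ) := by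
  rw [hy.meanCost_eq hT humax hu h]
  refine add_eq_left.2 (intervalIntegral.integral_zero_ae ?_)
  filter_upwards with t ht
  rw [uIoc_of_le hT] at ht
  refine Finset.sum_eq_zero fun z _ => mul_eq_zero_of_right _ (Finset.sum_eq_zero fun k _ => ?_)
  rw [hbang _ t ⟨ht.1.le, ht.2⟩, bangBang, mul_assoc, one_sub_sgn_mul, sub_self, zero_mul]

theorem measurable_sgn (s₀ : ℝ) : Measurable (sgn s₀) :=
  Measurable.ite measurableSet_Ioi measurable_const
    (Measurable.ite measurableSet_Iio measurable_const measurable_const)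

theorem sgn_mem_Icc (hs₀ : s₀ ∈ Icc (-1 : ℝ) 1) (a : ℝ) : sgn s₀ a ∈ Icc (-1 : ℝ) 1 := by
  rw [sgn]
  split_ifs
  exacts [by simp, by simp, hs₀]

theorem SolvesBackward.isAdmissible_bangBang (humax : 0 ≤ umax) (hs₀ : s₀ ∈ Icc (-1 : ℝ) 1)
    (hy : SolvesBackward N q v c umax T y) :
    IsAdmissible umax T (bangBang N v umax s₀ y) := by
  refine fun x k => ⟨fun t _ => ?_, ?_⟩
  · obtain ⟨h1, h2⟩ := sgn_mem_Icc hs₀ ((y t ᵥ* N.RD + v) k)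
    refine ⟨mul_nonneg (by positivity) (by linarith), ?_⟩
    calc umax / 2 * (1 - sgn s₀ ((y t ᵥ* N.RD + v) k)) ≤ umax / 2 * 2 :=
          mul_le_mul_of_nonneg_left (by linarith) (by positivity)
      _ = umax := by ring
  · have hc : Continuous fun t : Icc (0 : ℝ) T => (y t ᵥ* N.RD + v) k :=
      (continuous_apply k).comp (((continuousOn_iff_continuous_domRestrict.1
        hy.continuousOn).matrix_vecMul continuous_const).add continuous_const)
    exact measurable_const.mul (measurable_const.sub ((measurable_sgn s₀).comp hc.measurable))

/-- Admissibility says nothing outside `[0, T]`. Freezing the policy at the endpoints makes it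
regular at all times, and the cost does not see the change (`HasCost.congr`). -/
theorem IsAdmissible.exists_isRegularPolicy (hT : 0 ≤ T) (hu : IsAdmissible umax T u) :
    ∃ u', IsRegularPolicy umax u' ∧ ∀ x, ∀ t ∈ Icc 0 T, u' x t = u x t :=
  ⟨fun x t => u x (projIcc 0 T hT t), fun x k =>
    ⟨(hu x k).2.comp (continuous_projIcc (h := hT)).measurable,
      fun t => (hu x k).1 _ (projIcc 0 T hT t).2⟩,
    fun x t ht => by simp only [projIcc_of_mem hT ht]⟩

theorem SolvesBackward.exists_hasCost (hT : 0 ≤ T) (humax : 0 ≤ umax)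
    (hy : SolvesBackward N q v c umax T y) (hu : IsAdmissible umax T u) (x₀ : Fin n → ℕ) :
    ∃ a, HasCost.{w} N q v c T u x₀ a ∧ (y 0 ⬝ᵥ fun i => (x₀ i : ℝ)) ≤ a := by
  obtain ⟨u', hu', hagree⟩ := hu.exists_isRegularPolicy hT
  obtain ⟨P, hP⟩ := exists_isForwardSolution (T := T) N humax hu' x₀
  exact ⟨_, (hP.hasCost hT humax hu').congr hT hagree, hy.le_meanCost hT humax hu' hP⟩

theorem SolvesBackward.hasCost_bangBang (hT : 0 ≤ T) (humax : 0 ≤ umax)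
    (hs₀ : s₀ ∈ Icc (-1 : ℝ) 1) (hy : SolvesBackward N q v c umax T y) (x₀ : Fin n → ℕ) :
    HasCost.{w} N q v c T (bangBang N v umax s₀ y) x₀ (y 0 ⬝ᵥ fun i => (x₀ i : ℝ)) := by
  obtain ⟨u', hu', hagree⟩ := (hy.isAdmissible_bangBang humax hs₀).exists_isRegularPolicy hT
  obtain ⟨P, hP⟩ := exists_isForwardSolution (T := T) N humax hu' x₀
  rw [← hy.meanCost_bangBang hT humax hu' hagree hP]
  exact (hP.hasCost hT humax hu').congr hT hagree

end Verification

theorem proposition1 {n mu me : ℕ} (N : QueueNetwork n mu me)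
    (q : Fin n → ℝ) (v : Fin mu → ℝ) (c : Fin n → ℝ) (umax T s₀ : ℝ)
    (hq : ∀ i, 0 ≤ q i) (hv : ∀ k, 0 ≤ v k) (hc : ∀ i, 0 ≤ c i)
    (humax : 0 ≤ umax) (hT : 0 < T) (hs₀ : s₀ ∈ Set.Icc (-1 : ℝ) 1)
    (y : ℝ → Fin n → ℝ) (hy : SolvesBackward N q v c umax T y) :
    IsOptimalPolicy.{w} N q v c umax T (bangBang N v umax s₀ y) ∧
    (∀ x x' : Fin n → ℕ, ∀ t : ℝ,
      bangBang N v umax s₀ y x t = bangBang N v umax s₀ y x' t) ∧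
    (∀ x₀ : Fin n → ℕ,
      HasCost.{w} N q v c T (bangBang N v umax s₀ y) x₀ (y 0 ⬝ᵥ fun i => (x₀ i : ℝ)) ∧
      IsLeast {a : ℝ | ∃ u : Policy n mu, IsAdmissible umax T u ∧ HasCost.{w} N q v c T u x₀ a}
        (y 0 ⬝ᵥ fun i => (x₀ i : ℝ))) := by
  have hadm := hy.isAdmissible_bangBang humax hs₀
  have hbang := hy.hasCost_bangBang hT.le humax hs₀
  refine ⟨⟨hadm, fun u' hu' x₀ => ?_⟩, fun _ _ _ => rfl, fun x₀ => ⟨hbang x₀,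
    ⟨⟨_, hadm, hbang x₀⟩, ?_⟩⟩⟩
  · obtain ⟨a, ha, hle⟩ := hy.exists_hasCost hT.le humax hu' x₀
    exact ⟨_, a, hbang x₀, ha, hle⟩
  · rintro a ⟨u', hu', ha⟩
    obtain ⟨a', ha', hle⟩ := hy.exists_hasCost hT.le humax hu' x₀
    rwa [ha.unique ha']
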